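/- **Machines.** Let $\Sigma$ be an alphabet (finite, nonempty). A one-way probabilistic pushdown automaton (1ppda) has a finite set $Q$ of inner states, a stack alphabet $\Gamma$ (finite) with bottom marker $Z_0$, a finite set $\Theta\subseteq\Gamma^*$ with $\lambda\in\Theta$ (where $\lambda$ is the empty string), an initial state $q_0$, disjoint sets $Q_{acc},Q_{rej}\subseteq Q$, and transition probabilities $\delta(q,s,a\,|\,p,u)$ of going from state $q$ to state $p$ and replacing the topmost stack symbol $a$ by $u\in\Theta$, where $s$ is either a tape symbol that is read or $s=\lambda$ (no symbol is read, a $\lambda$-move). The bottom marker is never removed from, nor written anywhere else than at, the bottom of the stack. Put $\delta[q,s,a]=\sum_{p,u}\delta(q,s,a\,|\,p,u)$. The initial stack is $Z_0$. In an *endmarker 1ppda* the tape contains $¢x\$$ for the input $x\in\Sigma^*$; the machine stops when it enters a state of $Q_{acc}\cup Q_{rej}$, and accepts or rejects accordingly ($\lambda$-moves after reading $\$$ are allowed). For every other state $q$, all $a\in\Gamma$ and all tape symbols $\sigma$, $\delta[q,\sigma,a]+\delta[q,\lambda,a]=1$; the first move is not a $\lambda$-move. In a *no-endmarker 1ppda*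 the tape contains only $x$, and $Q=Q_{acc}\cup Q_{rej}$. The machine halts when all of $x$ has been read and it makes no further $\lambda$-move (in state $q$ with topmost symbol $a$ this has probability $1-\delta[q,\lambda,a]$); it accepts or rejects according to its state at that time. Again $\delta[q,\sigma,a]+\delta[q,\lambda,a]=1$, except for the first move: on a nonempty input the first move reads the first symbol, whereas on the empty input the first move may be a $\lambda$-move (accordingly $\delta[q_0,\sigma,Z_0]=1$ for $\sigma\in\Sigma$ and $\delta[q_0,\lambda,Z_0]\le 1$, and $q_0$ is never entered again). In both models all computation paths on every input are required to halt after finitely many moves. The acceptance (rejection) probability on $x$ is the sum of the probabilities of all accepting (rejecting) computation paths, and the recognized language is the set of $x$ with acceptance probability greater than $1/2$. Two 1ppda's are *error-equivalent* if they recognize the same language and, on every input, accept with the same probability and reject with the same probability (so that they err with the same probability). The *push size* is the least positive integer $e$ such that every string in $\Theta$ has length at most $e$. **Statement.** There is an absolute constant $C$ such that the following holds. For every endmarker 1ppda with $n$ states, stack alphabet size $m$ and push size $e$ there is an error-equivalent no-endmarker 1ppda which pushes at most one symbol per move (each move pops the topmost stack symbol $a$, or replaces $a$ by a single symbol, or pushes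 a single symbol on top of $a$; all strings in its $\Theta$ have length at most $2$), which has at most $$C\,e^2n^4m^4(2m)^{3enm}$$ states, and whose stack alphabet has size at most $$C\,e^3n^6m^6(2m)^{5enm}\,2^{t},\qquad t=2en^2m^2(2m)^{2enm}.$$ -/

import Mathlib

open scoped NNReal ENNReal

/-- A configuration of a one-way pushdown automaton: the inner state, the part of the input region
that has not been read yet (this determines the head position), and the stack content, listed from
the topmost symbol down to the bottom marker. -/
structure Config (T Q Γ : Type*) where
  state : Q
  input : List T
  stack : List Γ

/-- The data and the conditions common to both models of one-way probabilistic pushdown automata.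
`T` is the set of symbols that may occur in the input region, `Q` the set of inner states and `Γ`
the stack alphabet. In `δ q s a p u`, the argument `s = none` stands for a `λ`-move and
`s = some σ` for reading `σ`; the value is the probability of changing the state from `q` to `p`
and of replacing the topmost stack symbol `a` by the string `u`. -/
structure PPDACore (T Q Γ : Type*) where
  /-- the finite set of strings that may replace the topmost stack symbol -/
  Θ : Finset (List Γ)
  nil_mem : [] ∈ Θ
  δ : Q → Option T → Γ → Q → List Γ → ℝ≥0
  q₀ : Q
  Z₀ : Γ
  acc : Set Q
  rej : Set Q
  disjoint_acc_rej : Disjoint acc rej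
  /-- the transition function only concerns strings of `Θ` -/
  δ_eq_zero_of_notMem : ∀ q s a p u, u ∉ Θ → δ q s a p u = 0
  /-- the bottom marker is never written above the bottom -/
  δ_of_ne : ∀ q s a p u, 0 < δ q s a p u → a ≠ Z₀ → Z₀ ∉ u
  /-- the bottom marker is never removed -/
  δ_of_eq : ∀ q s p u, 0 < δ q s Z₀ p u → ∃ v, Z₀ ∉ v ∧ u = v ++ [Z₀]

namespace PPDACore

variable {T Q Γ : Type*}

/-- The halting states. -/
def halt (M : PPDACore T Q Γ) : Set Q := M.acc ∪ M.rej

/-- The push size: the least positive integer `e` such that all strings of `Θ` have length at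
most `e`. -/
noncomputable def pushSize (M : PPDACore T Q Γ) : ℕ :=
  sInf {e : ℕ | 0 < e ∧ ∀ u ∈ M.Θ, u.length ≤ e}

/-- Pushes add single symbols: every move pops the topmost stack symbol `a`, or replaces it by one
symbol, or pushes one symbol on top of `a`, leaving `a` unchanged. -/
def PushesSingleSymbols (M : PPDACore T Q Γ) : Prop :=
  (∀ u ∈ M.Θ, u.length ≤ 2) ∧
    ∀ q s a p u, 0 < M.δ q s a p u → u = [] ∨ (∃ b, u = [b]) ∨ ∃ b, u = [b, a]

/-- One move of positive probability. -/
inductive Step (M : PPDACore T Q Γ) : Config T Q Γ → Config T Q Γ → Prop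
  | lam (q : Q) (x : List T) (a : Γ) (w : List Γ) (p : Q) (u : List Γ) :
      0 < M.δ q none a p u → Step M ⟨q, x, a :: w⟩ ⟨p, x, u ++ w⟩
  | read (q : Q) (σ : T) (x : List T) (a : Γ) (w : List Γ) (p : Q) (u : List Γ) :
      0 < M.δ q (some σ) a p u → Step M ⟨q, σ :: x, a :: w⟩ ⟨p, x, u ++ w⟩

/-- No infinite computation path starts in the configuration `c`. -/
def NoInfinitePath (M : PPDACore T Q Γ) (c : Config T Q Γ) : Prop :=
  ¬ ∃ f : ℕ → Config T Q Γ, f 0 = c ∧ ∀ i, M.Step (f i) (f (i + 1))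

variable [Fintype Q]

/-- `δ[q, s, a]`, the total probability of the moves with label `s` in state `q` when the topmost
stack symbol is `a`. -/
def total (M : PPDACore T Q Γ) (q : Q) (s : Option T) (a : Γ) : ℝ≥0 :=
  ∑ p : Q, ∑ u ∈ M.Θ, M.δ q s a p u

/-- `M.pathSum final k c` is the sum, over all computation paths that start in `c` and consist of
`k` moves, of the product of the probabilities of the moves and of the weight `final` of the last
configuration. Distinct moves out of a configuration lead to distinct configurations, so that a
path is determined by its moves. -/
noncomputable def pathSum (M : PPDACore T Q Γ) (final : Config T Q Γ → ℝ≥0∞) :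
    ℕ → Config T Q Γ → ℝ≥0∞
  | 0, c => final c
  | _ + 1, ⟨_, _, []⟩ => 0
  | k + 1, ⟨q, [], a :: w⟩ =>
      ∑ p : Q, ∑ u ∈ M.Θ, (M.δ q none a p u : ℝ≥0∞) * pathSum M final k ⟨p, [], u ++ w⟩
  | k + 1, ⟨q, σ :: x, a :: w⟩ =>
      (∑ p : Q, ∑ u ∈ M.Θ,
        (M.δ q none a p u : ℝ≥0∞) * pathSum M final k ⟨p, σ :: x, u ++ w⟩) +
      ∑ p : Q, ∑ u ∈ M.Θ,
        (M.δ q (some σ) a p u : ℝ≥0∞) * pathSum M final k ⟨p, x, u ++ w⟩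

/-- The sum over computation paths of all finite lengths. -/
noncomputable def allPathSum (M : PPDACore T Q Γ) (final : Config T Q Γ → ℝ≥0∞)
    (c : Config T Q Γ) : ℝ≥0∞ :=
  ∑' k : ℕ, M.pathSum final k c

end PPDACore

/-- The symbols on the input tape of a machine with endmarkers. -/
inductive Tape (A : Type*)
  | left : Tape A
  | sym : A → Tape A
  | right : Tape A

/-- The input region of a machine with endmarkers: the input, enclosed by the two endmarkers. -/
def Tape.region {A : Type*} (x : List A) : List (Tape A) :=
  Tape.left :: (x.map Tape.sym ++ [Tape.right])

/-- One-way probabilistic pushdown automata with two endmarkers, input alphabet `A`. -/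
structure EndmarkerPPDA (A Q Γ : Type*) [Fintype Q] extends PPDACore (Tape A) Q Γ where
  /-- the machine stops as soon as it enters a halting state -/
  δ_halt : ∀ q ∈ toPPDACore.halt, ∀ s a p u, δ q s a p u = 0
  /-- the probability requirement -/
  total_add_total : ∀ q ∉ toPPDACore.halt, ∀ (σ : Tape A) (a : Γ),
    toPPDACore.total q (some σ) a + toPPDACore.total q none a = 1
  /-- the first move is not a `λ`-move -/
  total_init : toPPDACore.total q₀ none Z₀ = 0
  /-- no input admits an infinite computation path -/
  noInfinitePath : ∀ x : List A, toPPDACore.NoInfinitePath ⟨q₀, Tape.region x, [Z₀]⟩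
  /-- no computation path gets stuck in a non-halting state off the input region; together with
  the previous condition this says that all computation paths halt eventually -/
  notStuck : ∀ (x : List A) (q : Q) (a : Γ) (w : List Γ),
    Relation.ReflTransGen toPPDACore.Step ⟨q₀, Tape.region x, [Z₀]⟩ ⟨q, [], a :: w⟩ →
      q ∉ toPPDACore.halt → toPPDACore.total q none a = 1

namespace EndmarkerPPDA

variable {A Q Γ : Type*} [Fintype Q]

open Classical in
/-- The probability that the machine, on input `x`, halts in a state of the set `F` of halting
states. -/
noncomputable def outcomeProb (M : EndmarkerPPDA A Q Γ) (F : Set Q) (x : List A) : ℝ≥0∞ :=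
  M.allPathSum (fun c => if c.state ∈ F then 1 else 0) ⟨M.q₀, Tape.region x, [M.Z₀]⟩

/-- The acceptance probability. -/
noncomputable def accProb (M : EndmarkerPPDA A Q Γ) (x : List A) : ℝ≥0∞ :=
  M.outcomeProb M.acc x

/-- The rejection probability. -/
noncomputable def rejProb (M : EndmarkerPPDA A Q Γ) (x : List A) : ℝ≥0∞ :=
  M.outcomeProb M.rej x

/-- The recognized language. -/
def language (M : EndmarkerPPDA A Q Γ) : Language A := {x | 1 / 2 < M.accProb x}

end EndmarkerPPDA

/-- One-way probabilistic pushdown automata without endmarkers, input alphabet `A`.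

On a nonempty input the first move reads the first input symbol, and on the empty input the first
move may be a `λ`-move. The probability requirement in the initial situation is therefore stated
separately for the two cases. The initial state is not entered again, so that this concerns the
first move only. -/
structure NoEndmarkerPPDA (A Q Γ : Type*) [Fintype Q] extends PPDACore A Q Γ where
  /-- every state is accepting or rejecting -/
  acc_union_rej : acc ∪ rej = Set.univ
  /-- the probability requirement after the first move -/
  total_add_total : ∀ (q : Q) (σ : A) (a : Γ), (q, a) ≠ (q₀, Z₀) →
    toPPDACore.total q (some σ) a + toPPDACore.total q none a = 1
  /-- the probability requirement for the first move on a nonempty input -/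
  total_init_read : ∀ σ : A, toPPDACore.total q₀ (some σ) Z₀ = 1
  /-- the probability requirement for the first move on the empty input -/
  total_init_lam : toPPDACore.total q₀ none Z₀ ≤ 1
  /-- the initial state is not entered again -/
  δ_init : ∀ q s a u, δ q s a q₀ u = 0
  /-- on the empty input all computation paths halt eventually -/
  noInfinitePath_nil : toPPDACore.NoInfinitePath ⟨q₀, [], [Z₀]⟩
  /-- on nonempty inputs all computation paths halt eventually -/
  noInfinitePath_cons : ∀ (σ : A) (x : List A) (p : Q) (u : List Γ),
    0 < δ q₀ (some σ) Z₀ p u → toPPDACore.NoInfinitePath ⟨p, x, u⟩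

namespace NoEndmarkerPPDA

variable {A Q Γ : Type*} [Fintype Q]

open Classical in
/-- The probability of halting in the configuration `c`, in a state of `F`. The machine halts when
the whole input has been read and no further `λ`-move is made; in state `q` with topmost stack
symbol `a` the latter has probability `1 - δ[q, λ, a]`. -/
noncomputable def haltWeight (M : NoEndmarkerPPDA A Q Γ) (F : Set Q) :
    Config A Q Γ → ℝ≥0∞
  | ⟨q, [], a :: _⟩ => if q ∈ F then 1 - (M.total q none a : ℝ≥0∞) else 0
  | _ => 0

/-- The probability that the machine, on a given input, halts in a state of the set `F`. -/
noncomputable def outcomeProb (M : NoEndmarkerPPDA A Q Γ) (F : Set Q) : List A → ℝ≥0∞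
  | [] => M.allPathSum (M.haltWeight F) ⟨M.q₀, [], [M.Z₀]⟩
  | σ :: x => ∑ p : Q, ∑ u ∈ M.Θ,
      (M.δ M.q₀ (some σ) M.Z₀ p u : ℝ≥0∞) * M.allPathSum (M.haltWeight F) ⟨p, x, u⟩

/-- The acceptance probability. -/
noncomputable def accProb (M : NoEndmarkerPPDA A Q Γ) (x : List A) : ℝ≥0∞ :=
  M.outcomeProb M.acc x

/-- The rejection probability. -/
noncomputable def rejProb (M : NoEndmarkerPPDA A Q Γ) (x : List A) : ℝ≥0∞ :=
  M.outcomeProb M.rej x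

/-- The recognized language. -/
def language (M : NoEndmarkerPPDA A Q Γ) : Language A := {x | 1 / 2 < M.accProb x}

end NoEndmarkerPPDA

/-- Error-equivalence of a machine with endmarkers and a machine without: they recognize the same
language and accept, as well as reject, every input with the same probability; in particular they
err with the same probability on every input. -/
def ErrorEquivalent {A Q Γ Q' Γ' : Type*} [Fintype Q] [Fintype Q']
    (M : EndmarkerPPDA A Q Γ) (N : NoEndmarkerPPDA A Q' Γ') : Prop :=
  M.language = N.language ∧
    ∀ x : List A, M.accProb x = N.accProb x ∧ M.rejProb x = N.rejProb x

/-- `e² n⁴ m⁴ (2m)^(3enm)` -/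
def stateBound (n m e : ℕ) : ℕ :=
  e ^ 2 * n ^ 4 * m ^ 4 * (2 * m) ^ (3 * e * n * m)

/-- `e³ n⁶ m⁶ (2m)^(5enm) 2^t` with `t = 2 e n² m² (2m)^(2enm)` -/
def stackBound (n m e : ℕ) : ℕ :=
  e ^ 3 * n ^ 6 * m ^ 6 * (2 * m) ^ (5 * e * n * m) *
    2 ^ (2 * e * n ^ 2 * m ^ 2 * (2 * m) ^ (2 * e * n * m))

/-! A machine without endmarkers must at any moment be in a state carrying the verdict for the case
that the input ends now, and this verdict depends on the whole stack. The remedy is to store random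
bits instead of probabilities. Every stack symbol carries a vector `g : Q → Bool`, where `g p` is a
sampled verdict for `M` in state `p`, after the right endmarker, once this symbol has been popped.
When a symbol is pushed on `a`, its bits are drawn independently with means `annotatedValue a`, the
acceptance probabilities computed from `a` and its own bits. These are affine in the bits, so only
means matter (`map_popValue`), and by induction up the stack all means are correct
(`expect_topValue`).

Before each simulated move the simulator draws a verdict `b`. If the input is over, it halts with
probability `1 - δ[q,λ,a] = δ[q,$,a]`; hence `b` is biased by the probability of reading `$` and
accepting, divided by `δ[q,$,a]`. If the run goes on, `b` is forgotten. Simulated moves never look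
at annotations, so these keep their law: a pop integrates the top vector out, a replacement keeps
it, a push samples a new one. Averaged over annotations, the simulator therefore has the outcome
probabilities of `M` (`expect_simValue`, by induction on termination).

On a nonempty input the first move has to read, so the whole run of `M` up to halting or reading the
first symbol is compressed into one random choice. The resulting stack is kept in the finite control
and pushed symbol by symbol. This is possible because λ-moves from a terminating configuration raise
the stack by at most `e n m`: a state-symbol pair recurring above itself could be repeated forever
(`Surfaces.irrefl`), so each pair sees fewer pairs above it than its predecessor
(`length_le_surfaceRank`). Lists of length at most `3 e n m` give the number of states, and the
annotated alphabet has `m * 2 ^ n` symbols. -/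

namespace PPDACore

/-! ### Moves, termination as accessibility, shape of the stack -/

section Step

variable {T Q Γ : Type*}

/-- All computation paths starting in `c` are finite, as an accessibility statement. -/
def Terminates (M : PPDACore T Q Γ) (c : Config T Q Γ) : Prop :=
  Acc (fun d c => M.Step c d) c

theorem terminates_iff (M : PPDACore T Q Γ) (c : Config T Q Γ) :
    M.Terminates c ↔ M.NoInfinitePath c := by
  rw [← not_iff_not]
  unfold Terminates NoInfinitePath
  rw [not_acc_iff_exists_descending_chain, not_not]

theorem Terminates.of_step {M : PPDACore T Q Γ} {c d : Config T Q Γ} (h : M.Terminates c)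
    (hd : M.Step c d) : M.Terminates d :=
  Acc.inv h hd

theorem Terminates.of_reflTransGen {M : PPDACore T Q Γ} {c d : Config T Q Γ}
    (h : M.Terminates c) (hd : Relation.ReflTransGen M.Step c d) : M.Terminates d := by
  induction hd with
  | refl => exact h
  | tail _ h1 ih => exact ih.of_step h1

/-- Append unread input and lower stack content to a configuration. -/
def _root_.Config.extend (c : Config T Q Γ) (y : List T) (z : List Γ) : Config T Q Γ :=
  ⟨c.state, c.input ++ y, c.stack ++ z⟩

theorem Step.extend {M : PPDACore T Q Γ} {c d : Config T Q Γ} (h : M.Step c d) (y : List T)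
    (z : List Γ) : M.Step (c.extend y z) (d.extend y z) := by
  cases h with
  | lam q x a w p u h =>
    simpa [Config.extend] using Step.lam q (x ++ y) a (w ++ z) p u h
  | read q σ x a w p u h =>
    simpa [Config.extend] using Step.read q σ (x ++ y) a (w ++ z) p u h

theorem reflTransGen_extend {M : PPDACore T Q Γ} {c d : Config T Q Γ}
    (h : Relation.ReflTransGen M.Step c d) (y : List T) (z : List Γ) :
    Relation.ReflTransGen M.Step (c.extend y z) (d.extend y z) :=
  Relation.ReflTransGen.lift (fun c : Config T Q Γ => c.extend y z)
    (fun _ _ h => Step.extend h y z) _ _ h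

theorem transGen_extend {M : PPDACore T Q Γ} {c d : Config T Q Γ}
    (h : Relation.TransGen M.Step c d) (y : List T) (z : List Γ) :
    Relation.TransGen M.Step (c.extend y z) (d.extend y z) :=
  Relation.TransGen.lift (fun c : Config T Q Γ => c.extend y z)
    (fun _ _ h => Step.extend h y z) _ _ h

/-- Every run lifts to a run with additional unread input and additional stack below, so an infinite
one would lift too. -/
theorem Terminates.of_extend {M : PPDACore T Q Γ} {c : Config T Q Γ} {y : List T} {z : List Γ}
    (h : M.Terminates (c.extend y z)) : M.Terminates c :=
  Subrelation.accessible (r := InvImage (fun d c => M.Step c d) fun c : Config T Q Γ => c.extend y z)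
    (fun h => Step.extend h y z)
    (InvImage.accessible (fun c : Config T Q Γ => c.extend y z) h)

theorem mem_of_pos (M : PPDACore T Q Γ) {q : Q} {s : Option T} {a : Γ} {p : Q} {u : List Γ}
    (h : 0 < M.δ q s a p u) : u ∈ M.Θ := by
  by_contra hu
  rw [M.δ_eq_zero_of_notMem _ _ _ _ _ hu] at h
  exact lt_irrefl _ h

theorem pushSize_spec (M : PPDACore T Q Γ) :
    0 < M.pushSize ∧ ∀ u ∈ M.Θ, u.length ≤ M.pushSize := by
  refine Nat.sInf_mem (s := {e : ℕ | 0 < e ∧ ∀ u ∈ M.Θ, u.length ≤ e})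
    ⟨M.Θ.sup List.length + 1, Nat.succ_pos _, fun u hu => ?_⟩
  exact (Finset.le_sup (f := List.length) hu).trans (Nat.le_succ _)

theorem length_le_pushSize (M : PPDACore T Q Γ) {q : Q} {s : Option T} {a : Γ} {p : Q}
    {u : List Γ} (h : 0 < M.δ q s a p u) : u.length ≤ M.pushSize :=
  M.pushSize_spec.2 u (M.mem_of_pos h)

/-- The stack consists of the bottom marker, with other symbols above. -/
def StackOK (M : PPDACore T Q Γ) (w : List Γ) : Prop := ∃ z, M.Z₀ ∉ z ∧ w = z ++ [M.Z₀]

theorem StackOK.ne_nil {M : PPDACore T Q Γ} {w : List Γ} (h : M.StackOK w) : w ≠ [] := by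
  obtain ⟨z, -, rfl⟩ := h
  simp

theorem StackOK.replace {M : PPDACore T Q Γ} {a : Γ} {w : List Γ} (h : M.StackOK (a :: w))
    {q : Q} {s : Option T} {p : Q} {u : List Γ} (hu : 0 < M.δ q s a p u) :
    M.StackOK (u ++ w) := by
  obtain ⟨z, hz, hzw⟩ := h
  rcases z with _ | ⟨b, z⟩
  · obtain ⟨rfl, rfl⟩ : a = M.Z₀ ∧ w = [] := by simpa using hzw
    obtain ⟨v, hv, rfl⟩ := M.δ_of_eq _ _ _ _ hu
    exact ⟨v, hv, by simp⟩
  · obtain ⟨rfl, rfl⟩ : a = b ∧ w = z ++ [M.Z₀] := by simpa using hzw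
    simp only [List.mem_cons, not_or] at hz
    have := M.δ_of_ne _ _ _ _ _ hu (Ne.symm hz.1)
    exact ⟨u ++ z, by simp [this, hz.2], by simp⟩

theorem StackOK.step {M : PPDACore T Q Γ} {c d : Config T Q Γ} (h : M.StackOK c.stack)
    (hd : M.Step c d) : M.StackOK d.stack := by
  cases hd with
  | lam q x a w p u hu => exact h.replace hu
  | read q σ x a w p u hu => exact h.replace hu

/-- The only bottom marker is the last entry, and this lies in the nonempty part `w`. -/
theorem StackOK.notMem_of_append {M : PPDACore T Q Γ} {r w : List Γ} (h : M.StackOK (r ++ w))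
    (hw : w ≠ []) : M.Z₀ ∉ r := by
  obtain ⟨z, hz, hzw⟩ := h
  obtain ⟨w', b, rfl⟩ := List.eq_nil_or_concat w |>.resolve_left hw
  simp only [List.concat_eq_append, ← List.append_assoc] at hzw
  have := (List.append_inj' hzw rfl).1
  subst this
  simp at hz
  exact hz.1

end Step

/-! ### Expectations over moves and over computation paths -/

section Sums

variable {T Q Γ : Type*} [Fintype Q]

/-- The weighted sum of `H` over all moves with label `s` in state `q` with topmost symbol `a`. -/
noncomputable def moveSum (M : PPDACore T Q Γ) (q : Q) (s : Option T) (a : Γ)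
    (H : Q → List Γ → ℝ≥0∞) : ℝ≥0∞ :=
  ∑ p : Q, ∑ u ∈ M.Θ, (M.δ q s a p u : ℝ≥0∞) * H p u

/-- The expectation of `V` after one move. -/
noncomputable def next (M : PPDACore T Q Γ) (V : Config T Q Γ → ℝ≥0∞) : Config T Q Γ → ℝ≥0∞
  | ⟨_, _, []⟩ => 0
  | ⟨q, [], a :: w⟩ => M.moveSum q none a fun p u => V ⟨p, [], u ++ w⟩
  | ⟨q, σ :: x, a :: w⟩ => (M.moveSum q none a fun p u => V ⟨p, σ :: x, u ++ w⟩) +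
      M.moveSum q (some σ) a fun p u => V ⟨p, x, u ++ w⟩

variable (M : PPDACore T Q Γ)

theorem moveSum_congr {q : Q} {s : Option T} {a : Γ} {H H' : Q → List Γ → ℝ≥0∞}
    (h : ∀ p u, 0 < M.δ q s a p u → H p u = H' p u) :
    M.moveSum q s a H = M.moveSum q s a H' := by
  refine Finset.sum_congr rfl fun p _ => Finset.sum_congr rfl fun u _ => ?_
  rcases eq_zero_or_pos (M.δ q s a p u) with h0 | h0
  · simp [h0]
  · rw [h p u h0]

theorem moveSum_mono {q : Q} {s : Option T} {a : Γ} {H H' : Q → List Γ → ℝ≥0∞}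
    (h : ∀ p u, H p u ≤ H' p u) : M.moveSum q s a H ≤ M.moveSum q s a H' :=
  Finset.sum_le_sum fun p _ => Finset.sum_le_sum fun u _ => mul_le_mul_right (h p u) _

theorem moveSum_add (q : Q) (s : Option T) (a : Γ) (H H' : Q → List Γ → ℝ≥0∞) :
    (M.moveSum q s a fun p u => H p u + H' p u) = M.moveSum q s a H + M.moveSum q s a H' := by
  simp only [moveSum, mul_add, Finset.sum_add_distrib]

theorem moveSum_const_mul (q : Q) (s : Option T) (a : Γ) (k : ℝ≥0∞) (H : Q → List Γ → ℝ≥0∞) :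
    (M.moveSum q s a fun p u => k * H p u) = k * M.moveSum q s a H := by
  simp only [moveSum, Finset.mul_sum, mul_left_comm]

theorem moveSum_sum {ι : Type*} (I : Finset ι) (q : Q) (s : Option T) (a : Γ)
    (H : ι → Q → List Γ → ℝ≥0∞) :
    (M.moveSum q s a fun p u => ∑ i ∈ I, H i p u) = ∑ i ∈ I, M.moveSum q s a (H i) := by
  simp only [moveSum, Finset.mul_sum]
  rw [Finset.sum_comm]
  simp only [Finset.sum_comm (s := I)]
  exact Finset.sum_comm

theorem moveSum_tsum (q : Q) (s : Option T) (a : Γ) (H : ℕ → Q → List Γ → ℝ≥0∞) :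
    (M.moveSum q s a fun p u => ∑' k, H k p u) = ∑' k, M.moveSum q s a (H k) := by
  simp only [moveSum]
  rw [Summable.tsum_finsetSum fun _ _ => ENNReal.summable]
  refine Finset.sum_congr rfl fun p _ => ?_
  rw [Summable.tsum_finsetSum fun _ _ => ENNReal.summable]
  refine Finset.sum_congr rfl fun u _ => ?_
  rw [ENNReal.tsum_mul_left]

theorem moveSum_one (q : Q) (s : Option T) (a : Γ) :
    (M.moveSum q s a fun _ _ => 1) = M.total q s a := by
  simp [moveSum, total]

theorem moveSum_eq_zero {q : Q} {s : Option T} {a : Γ} (h : ∀ p u, M.δ q s a p u = 0)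
    (H : Q → List Γ → ℝ≥0∞) : M.moveSum q s a H = 0 := by
  simp [moveSum, h]

theorem next_congr {c : Config T Q Γ} {V V' : Config T Q Γ → ℝ≥0∞}
    (h : ∀ d, M.Step c d → V d = V' d) : M.next V c = M.next V' c := by
  obtain ⟨q, x, w⟩ := c
  rcases w with _ | ⟨a, w⟩
  · simp only [next]
  rcases x with _ | ⟨σ, x⟩
  · exact M.moveSum_congr fun p u hu => h _ (Step.lam _ _ _ _ _ _ hu)
  · exact congrArg₂ (· + ·) (M.moveSum_congr fun p u hu => h _ (Step.lam _ _ _ _ _ _ hu))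
      (M.moveSum_congr fun p u hu => h _ (Step.read _ _ _ _ _ _ _ hu))

theorem next_mono {V V' : Config T Q Γ → ℝ≥0∞} (h : ∀ d, V d ≤ V' d) (c : Config T Q Γ) :
    M.next V c ≤ M.next V' c := by
  obtain ⟨q, x, w⟩ := c
  rcases w with _ | ⟨a, w⟩
  · simp only [next, le_refl]
  rcases x with _ | ⟨σ, x⟩
  · exact M.moveSum_mono fun p u => h _
  · exact add_le_add (M.moveSum_mono fun p u => h _) (M.moveSum_mono fun p u => h _)

theorem next_sum_mul {ι : Type*} (I : Finset ι) (k : ι → ℝ≥0∞)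
    (V : ι → Config T Q Γ → ℝ≥0∞) (c : Config T Q Γ) :
    M.next (fun d => ∑ i ∈ I, k i * V i d) c = ∑ i ∈ I, k i * M.next (V i) c := by
  obtain ⟨q, x, w⟩ := c
  rcases w with _ | ⟨a, w⟩
  · simp [next]
  rcases x with _ | ⟨σ, x⟩
  · simp only [next, moveSum_sum, moveSum_const_mul]
  · simp only [next, moveSum_sum, moveSum_const_mul, mul_add, Finset.sum_add_distrib]

theorem next_tsum (V : ℕ → Config T Q Γ → ℝ≥0∞) (c : Config T Q Γ) :
    M.next (fun d => ∑' k, V k d) c = ∑' k, M.next (V k) c := by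
  obtain ⟨q, x, w⟩ := c
  rcases w with _ | ⟨a, w⟩
  · simp [next]
  rcases x with _ | ⟨σ, x⟩
  · simp only [next, moveSum_tsum]
  · simp only [next, moveSum_tsum, ENNReal.tsum_add]

theorem pathSum_succ (final : Config T Q Γ → ℝ≥0∞) (k : ℕ) (c : Config T Q Γ) :
    M.pathSum final (k + 1) c = M.next (M.pathSum final k) c := by
  obtain ⟨q, x, w⟩ := c
  rcases w with _ | ⟨a, w⟩
  · simp only [next, pathSum]
  rcases x with _ | ⟨σ, x⟩
  · simp only [next, pathSum, moveSum]
  · simp only [next, pathSum, moveSum]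

/-- First-step analysis. Most later identities follow from this recursion by induction on
termination, without touching the series. -/
theorem allPathSum_eq (final : Config T Q Γ → ℝ≥0∞) (c : Config T Q Γ) :
    M.allPathSum final c = final c + M.next (M.allPathSum final) c := by
  have h : M.allPathSum final = fun d => ∑' k, M.pathSum final k d := rfl
  rw [h, next_tsum]
  simp only [← pathSum_succ]
  rw [tsum_eq_zero_add' ENNReal.summable]
  simp only [pathSum]

theorem pathSum_sum_mul {ι : Type*} (I : Finset ι) (k : ι → ℝ≥0∞)
    (f : ι → Config T Q Γ → ℝ≥0∞) (j : ℕ) (c : Config T Q Γ) :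
    M.pathSum (fun d => ∑ i ∈ I, k i * f i d) j c = ∑ i ∈ I, k i * M.pathSum (f i) j c := by
  induction j generalizing c with
  | zero => simp only [pathSum]
  | succ j ih => simp only [pathSum_succ, ← next_sum_mul, ← ih]

theorem allPathSum_sum_mul {ι : Type*} (I : Finset ι) (k : ι → ℝ≥0∞)
    (f : ι → Config T Q Γ → ℝ≥0∞) (c : Config T Q Γ) :
    M.allPathSum (fun d => ∑ i ∈ I, k i * f i d) c = ∑ i ∈ I, k i * M.allPathSum (f i) c := by
  simp only [allPathSum, pathSum_sum_mul]
  rw [Summable.tsum_finsetSum fun _ _ => ENNReal.summable]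
  simp only [ENNReal.tsum_mul_left]

theorem next_zero (c : Config T Q Γ) : M.next (fun _ => 0) c = 0 := by
  simpa using M.next_sum_mul (∅ : Finset ℕ) (fun _ => 0) (fun _ _ => 0) c

theorem next_add (V V' : Config T Q Γ → ℝ≥0∞) (c : Config T Q Γ) :
    M.next (fun d => V d + V' d) c = M.next V c + M.next V' c := by
  simpa using M.next_sum_mul (Finset.univ : Finset Bool) (fun _ => 1) (fun b => cond b V V') c

/-- At each configuration the final weight and the continuation share one unit of mass, so the
partial sums over path lengths stay bounded. Termination plays no role. -/
theorem allPathSum_le_one {final : Config T Q Γ → ℝ≥0∞}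
    (h : ∀ c, final c + M.next (fun _ => 1) c ≤ 1) (c : Config T Q Γ) :
    M.allPathSum final c ≤ 1 := by
  refine ENNReal.tsum_le_of_sum_range_le fun K => ?_
  induction K generalizing c with
  | zero => simp
  | succ K ih =>
    rw [Finset.sum_range_succ']
    simp only [pathSum_succ]
    have h1 := M.next_sum_mul (Finset.range K) (fun _ => 1) (M.pathSum final) c
    simp only [one_mul] at h1
    rw [← h1, add_comm]
    exact (add_le_add le_rfl (M.next_mono ih c)).trans (h c)

theorem exists_step_of_next_ne_zero {V : Config T Q Γ → ℝ≥0∞} {c : Config T Q Γ}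
    (h : M.next V c ≠ 0) : ∃ d, M.Step c d ∧ V d ≠ 0 := by
  by_contra hc
  push Not at hc
  rw [M.next_congr hc, next_zero] at h
  exact h rfl

theorem exists_reflTransGen_of_allPathSum_ne_zero {final : Config T Q Γ → ℝ≥0∞}
    {c : Config T Q Γ} (h : M.allPathSum final c ≠ 0) :
    ∃ d, Relation.ReflTransGen M.Step c d ∧ final d ≠ 0 := by
  obtain ⟨k, hk⟩ : ∃ k, M.pathSum final k c ≠ 0 := by
    by_contra hc
    push Not at hc
    exact h (by simp [allPathSum, hc])
  clear h
  induction k generalizing c with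
  | zero => exact ⟨c, .refl, hk⟩
  | succ k ih =>
    rw [pathSum_succ] at hk
    obtain ⟨d, hd, hd'⟩ := M.exists_step_of_next_ne_zero hk
    obtain ⟨d', h1, h2⟩ := ih hd'
    exact ⟨d', .head hd h1, h2⟩

end Sums

end PPDACore

namespace PPDACore

/-! ### Stack height along λ-paths -/

section Height

variable {T Q Γ : Type*} {M : PPDACore T Q Γ}

/-- A path of `λ`-moves that starts with the stack `s ++ t` either never touches `t`, or passes
through a configuration whose stack is `t`. -/
theorem reflTransGen_append_cases {p p' : Q} {s t w : List Γ}
    (h : Relation.ReflTransGen M.Step ⟨p, [], s ++ t⟩ ⟨p', [], w⟩) :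
    (∃ y, w = y ++ t ∧ Relation.ReflTransGen M.Step ⟨p, [], s⟩ ⟨p', [], y⟩) ∨
    ∃ r, Relation.ReflTransGen M.Step ⟨p, [], s⟩ ⟨r, [], []⟩ ∧
      Relation.ReflTransGen M.Step ⟨r, [], t⟩ ⟨p', [], w⟩ := by
  generalize hc : (⟨p, [], s ++ t⟩ : Config T Q Γ) = c at h
  induction h using Relation.ReflTransGen.head_induction_on generalizing p s with
  | refl =>
    injection hc with h1 h2 h3
    subst h1 h3
    exact .inl ⟨s, rfl, .refl⟩
  | head hstep hrest ih =>
    subst hc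
    rcases s with _ | ⟨a, s⟩
    · exact .inr ⟨p, .refl, .head hstep hrest⟩
    · cases hstep with
      | lam _ _ _ _ r u hu =>
        have h1 : M.Step ⟨p, [], a :: s⟩ ⟨r, [], u ++ s⟩ := Step.lam _ _ _ _ _ _ hu
        rcases ih (p := r) (s := u ++ s) (by simp) with ⟨y, hy, h2⟩ | ⟨r', h2, h3⟩
        · exact .inl ⟨y, hy, .head h1 h2⟩
        · exact .inr ⟨r', .head h1 h2, h3⟩

theorem input_eq_nil_of_reflTransGen {c d : Config T Q Γ}
    (h : Relation.ReflTransGen M.Step c d) (hc : c.input = []) : d.input = [] := by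
  induction h with
  | refl => exact hc
  | tail _ h ih => cases h <;> simp_all

/-- If the height of the stack exceeds the initial height by at most `N` on `λ`-paths from all
surface pairs that are reachable from `(p, u)`, then the same holds for `(p, u)`. -/
theorem length_le_of_surface {N : ℕ} {p p' : Q} {u w : List Γ}
    (hN : ∀ r b z, Relation.ReflTransGen M.Step ⟨p, [], u⟩ ⟨r, [], b :: z⟩ →
      ∀ r' y, Relation.ReflTransGen M.Step ⟨r, [], [b]⟩ ⟨r', [], y⟩ → y.length ≤ 1 + N)
    (h : Relation.ReflTransGen M.Step ⟨p, [], u⟩ ⟨p', [], w⟩) : w.length ≤ u.length + N := by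
  induction u generalizing p with
  | nil =>
    rcases h.cases_head with h | ⟨d, hd, -⟩
    · injection h with _ _ h
      subst h
      simp
    · cases hd
  | cons b u ih =>
    -- Either `u` stays untouched and only what grew out of `b` can add height, or `b` has vanished
    -- and the height comes from `u` alone.
    rcases reflTransGen_append_cases (s := [b]) (t := u) h with ⟨y, rfl, hy⟩ | ⟨r, h1, h2⟩
    · have := hN p b u .refl p' y hy
      simp
      omega
    · have h1' : Relation.ReflTransGen M.Step ⟨p, [], b :: u⟩ ⟨r, [], u⟩ := by
        simpa [Config.extend] using reflTransGen_extend h1 [] u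
      have := ih (p := r) (fun r' b' z hz => hN r' b' z (h1'.trans hz)) h2
      simp
      omega

/-- The pair `y` occurs as state and topmost symbol on a nonempty `λ`-path from the pair `x`. -/
def Surfaces (M : PPDACore T Q Γ) (x y : Q × Γ) : Prop :=
  ∃ z, Relation.TransGen M.Step ⟨x.1, [], [x.2]⟩ ⟨y.1, [], y.2 :: z⟩

theorem Surfaces.trans {x y z : Q × Γ} (h : M.Surfaces x y) (h' : M.Surfaces y z) :
    M.Surfaces x z := by
  obtain ⟨t, ht⟩ := h
  obtain ⟨t', ht'⟩ := h'
  refine ⟨t' ++ t, ht.trans ?_⟩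
  simpa [Config.extend] using transGen_extend ht' [] t

theorem Surfaces.terminates {x y : Q × Γ} (h : M.Surfaces x y)
    (hx : M.Terminates ⟨x.1, [], [x.2]⟩) : M.Terminates ⟨y.1, [], [y.2]⟩ := by
  obtain ⟨z, hz⟩ := h
  refine Terminates.of_extend (y := []) (z := z) ?_
  exact hx.of_reflTransGen hz.to_reflTransGen

/-- A pair surfacing from itself can be pumped: the same moves repeat above whatever the previous
round left on the stack, which gives an infinite path. -/
theorem Surfaces.irrefl {x : Q × Γ} (hx : M.Terminates ⟨x.1, [], [x.2]⟩) :
    ¬ M.Surfaces x x := by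
  rintro ⟨z, hz⟩
  have hacc : Acc (Relation.TransGen fun d c => M.Step c d) ⟨x.1, [], [x.2]⟩ :=
    Acc.transGen hx
  have key : ∀ c : Config T Q Γ, Acc (Relation.TransGen fun d c => M.Step c d) c →
      ∀ t, c ≠ ⟨x.1, [], x.2 :: t⟩ := by
    intro c hc
    induction hc with
    | intro c _ ih =>
      rintro t rfl
      refine ih ⟨x.1, [], x.2 :: (z ++ t)⟩ ?_ _ rfl
      have h1 : Relation.TransGen M.Step ⟨x.1, [], x.2 :: t⟩ ⟨x.1, [], x.2 :: (z ++ t)⟩ := by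
        simpa [Config.extend] using transGen_extend hz [] t
      exact Relation.transGen_swap.2 h1
  exact key _ hacc [] rfl

variable [Fintype Q] [Fintype Γ]

open Classical in
/-- The number of pairs that surface from `x`. -/
noncomputable def surfaceRank (M : PPDACore T Q Γ) (x : Q × Γ) : ℕ :=
  (Finset.univ.filter fun y => M.Surfaces x y).card

/-- Transitivity gives the inclusion of the two sets of pairs, and `y` itself lies only in the
larger one. -/
theorem surfaceRank_lt {x y : Q × Γ} (hx : M.Terminates ⟨x.1, [], [x.2]⟩)
    (h : M.Surfaces x y) : M.surfaceRank y < M.surfaceRank x := by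
  classical
  refine Finset.card_lt_card ⟨fun z hz => ?_, fun hsub => ?_⟩
  · simp only [Finset.mem_filter, Finset.mem_univ, true_and] at hz ⊢
    exact h.trans hz
  · have : y ∈ Finset.univ.filter fun z => M.Surfaces y z := hsub (by simpa using h)
    simp only [Finset.mem_filter, Finset.mem_univ, true_and] at this
    exact Surfaces.irrefl (h.terminates hx) this

theorem surfaceRank_le (x : Q × Γ) :
    M.surfaceRank x ≤ Fintype.card Q * Fintype.card Γ := by
  rw [← Fintype.card_prod]
  exact Finset.card_le_univ _

/-- The first move leaves at most `pushSize` symbols, and every pair surfacing afterwards has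
smaller rank. So each unit of rank pays for at most `pushSize` symbols. -/
theorem length_le_surfaceRank {N : ℕ} {q p : Q} {a : Γ} {w : List Γ}
    (hN : M.surfaceRank (q, a) ≤ N) (hq : M.Terminates ⟨q, [], [a]⟩)
    (h : Relation.ReflTransGen M.Step ⟨q, [], [a]⟩ ⟨p, [], w⟩) :
    w.length ≤ 1 + M.pushSize * N := by
  induction N using Nat.strong_induction_on generalizing q p a w with
  | _ N ih =>
    rcases h.cases_head with h | ⟨d, hd, hdw⟩
    · injection h with _ _ h
      subst h
      simp
    · cases hd with
      | lam _ _ _ _ r u hu =>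
        have hstep : M.Step ⟨q, [], [a]⟩ ⟨r, [], u ++ []⟩ := Step.lam _ _ _ _ _ _ hu
        rw [List.append_nil] at hdw hstep
        by_cases hu0 : ∃ y, M.Surfaces (q, a) y
        · obtain ⟨y, hy⟩ := hu0
          have hpos : 0 < N := (Nat.zero_le _).trans_lt ((surfaceRank_lt hq hy).trans_le hN)
          have := length_le_of_surface (N := M.pushSize * (N - 1)) (fun r' b z hz r'' y hy => by
            have hs : M.Surfaces (q, a) (r', b) := ⟨z, Relation.TransGen.head' hstep hz⟩
            have hlt := surfaceRank_lt hq hs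
            have ht : M.Terminates ⟨r', [], [b]⟩ := hs.terminates hq
            exact ih (N - 1) (by omega) (by omega) ht hy) hdw
          have hlen := M.length_le_pushSize hu
          obtain ⟨k, rfl⟩ : ∃ k, N = k + 1 := ⟨N - 1, by omega⟩
          simp only [Nat.add_sub_cancel] at this
          rw [mul_add]
          omega
        · have := length_le_of_surface (N := 0) (fun r' b z hz r'' y hy => by
            exact absurd ⟨(r', b), z, Relation.TransGen.head' hstep hz⟩ hu0) hdw
          -- When no pair surfaces, the move must have popped `a`; otherwise the new topmost symbol
          -- would surface.
          rcases u with _ | ⟨b, u⟩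
          · simp at this
            simp [this]
          · exact absurd ⟨(r, b), u, Relation.TransGen.single hstep⟩ hu0

theorem length_le_of_terminates {p q : Q} {u w : List Γ} (hp : M.Terminates ⟨p, [], u⟩)
    (h : Relation.ReflTransGen M.Step ⟨p, [], u⟩ ⟨q, [], w⟩) :
    w.length ≤ u.length + M.pushSize * (Fintype.card Q * Fintype.card Γ) := by
  refine length_le_of_surface (fun r b z hz r' y hy => ?_) h
  refine length_le_surfaceRank (surfaceRank_le _) ?_ hy
  exact Terminates.of_extend (y := []) (z := z) (hp.of_reflTransGen hz)

end Height

end PPDACore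

/-- This is how an average over annotations passes through a move of `M`: a linear functional
commutes with the finite sum over moves. -/
theorem PPDACore.map_moveSum {T Q Γ X : Type*} [Fintype Q] (M : PPDACore T Q Γ)
    (L : (X → ℝ≥0∞) →ₗ[ℝ≥0∞] ℝ≥0∞) (q : Q) (s : Option T) (a : Γ)
    (H : X → Q → List Γ → ℝ≥0∞) :
    L (fun x => M.moveSum q s a (H x)) = M.moveSum q s a fun p u => L fun x => H x p u := by
  have h : (fun x => M.moveSum q s a (H x)) =
      ∑ p : Q, ∑ u ∈ M.Θ, (M.δ q s a p u : ℝ≥0∞) • fun x => H x p u := by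
    ext x
    simp [PPDACore.moveSum]
  rw [h]
  simp only [map_sum, map_smul, smul_eq_mul, PPDACore.moveSum]

/-! ### Outcome probabilities of the given machine -/

namespace EndmarkerPPDA

variable {A Q Γ : Type*} [Fintype Q] (M : EndmarkerPPDA A Q Γ)

/-- Reachability from the initial configuration on some input. -/
def Reachable (c : Config (Tape A) Q Γ) : Prop :=
  ∃ x : List A, Relation.ReflTransGen M.Step ⟨M.q₀, Tape.region x, [M.Z₀]⟩ c

variable {M}

theorem reachable_init (x : List A) : M.Reachable ⟨M.q₀, Tape.region x, [M.Z₀]⟩ := ⟨x, .refl⟩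

theorem Reachable.step {c d : Config (Tape A) Q Γ} (h : M.Reachable c) (hd : M.Step c d) :
    M.Reachable d :=
  let ⟨x, hx⟩ := h
  ⟨x, hx.tail hd⟩

theorem Reachable.terminates {c : Config (Tape A) Q Γ} (h : M.Reachable c) : M.Terminates c :=
  let ⟨x, hx⟩ := h
  ((M.terminates_iff _).2 (M.noInfinitePath x)).of_reflTransGen hx

theorem Reachable.stackOK {c : Config (Tape A) Q Γ} (h : M.Reachable c) : M.StackOK c.stack := by
  obtain ⟨x, hx⟩ := h
  induction hx with
  | refl => exact ⟨[], by simp, rfl⟩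
  | tail _ h ih => exact ih.step h

variable (M)

theorem total_none_le_one (q : Q) (a : Γ) : M.total q none a ≤ 1 := by
  by_cases hq : q ∈ M.halt
  · simp [PPDACore.total, M.δ_halt q hq]
  · rw [← M.total_add_total q hq Tape.left a]
    exact le_add_self

theorem next_eq_zero_of_halt (V : Config (Tape A) Q Γ → ℝ≥0∞) {c : Config (Tape A) Q Γ}
    (hc : c.state ∈ M.halt) : M.next V c = 0 := by
  obtain ⟨q, x, w⟩ := c
  rcases w with _ | ⟨a, w⟩
  · simp only [PPDACore.next]
  rcases x with _ | ⟨σ, x⟩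
  · exact M.moveSum_eq_zero (M.δ_halt q hc _ _) _
  · simp only [PPDACore.next]
    rw [M.moveSum_eq_zero (M.δ_halt q hc _ _), M.moveSum_eq_zero (M.δ_halt q hc _ _), add_zero]

theorem next_one_le (c : Config (Tape A) Q Γ) : M.next (fun _ => 1) c ≤ 1 := by
  by_cases hc : c.state ∈ M.halt
  · rw [M.next_eq_zero_of_halt _ hc]
    exact zero_le_one
  obtain ⟨q, x, w⟩ := c
  rcases w with _ | ⟨a, w⟩
  · simp only [PPDACore.next, zero_le_one]
  rcases x with _ | ⟨σ, x⟩
  · simp only [PPDACore.next, PPDACore.moveSum_one]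
    exact_mod_cast M.total_none_le_one q a
  · simp only [PPDACore.next, PPDACore.moveSum_one]
    rw [add_comm]
    exact_mod_cast (M.total_add_total q hc σ a).le

/-- With input left this is the probability requirement; with none left it is `notStuck`, and this
is where reachability matters. -/
theorem next_one_eq {c : Config (Tape A) Q Γ} (hc : c.state ∉ M.halt) (h : M.Reachable c) :
    M.next (fun _ => 1) c = 1 := by
  have hne := h.stackOK.ne_nil
  obtain ⟨q, x, w⟩ := c
  rcases w with _ | ⟨a, w⟩
  · exact absurd rfl hne
  rcases x with _ | ⟨σ, x⟩
  · simp only [PPDACore.next, PPDACore.moveSum_one]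
    obtain ⟨x, hx⟩ := h
    exact_mod_cast M.notStuck x q a w hx hc
  · simp only [PPDACore.next, PPDACore.moveSum_one]
    rw [add_comm]
    exact_mod_cast M.total_add_total q hc σ a

/-- The accepting or the rejecting states. -/
def verdict (β : Bool) : Set Q := cond β M.acc M.rej

theorem verdict_subset (β : Bool) : M.verdict β ⊆ M.halt := by
  cases β
  · exact Set.subset_union_right
  · exact Set.subset_union_left

open Classical in
/-- The probability that a computation started in `c` ends in acceptance (`β = true`) or in
rejection (`β = false`). -/
noncomputable def value (β : Bool) (c : Config (Tape A) Q Γ) : ℝ≥0∞ :=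
  M.allPathSum (fun c => if c.state ∈ M.verdict β then 1 else 0) c

open Classical in
theorem value_of_halt (β : Bool) {c : Config (Tape A) Q Γ} (hc : c.state ∈ M.halt) :
    M.value β c = if c.state ∈ M.verdict β then 1 else 0 := by
  rw [value, PPDACore.allPathSum_eq, M.next_eq_zero_of_halt _ hc, add_zero]

theorem value_of_not_halt (β : Bool) {c : Config (Tape A) Q Γ} (hc : c.state ∉ M.halt) :
    M.value β c = M.next (M.value β) c := by
  conv_lhs => rw [value, PPDACore.allPathSum_eq]
  rw [if_neg fun h => hc (M.verdict_subset β h), zero_add]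
  rfl

/-- Reachable configurations lose no mass before halting. Thanks to this, the rejecting case of
`expect_endPart` follows from the accepting one. -/
theorem value_add_value {c : Config (Tape A) Q Γ} (h : M.Reachable c) :
    M.value true c + M.value false c = 1 := by
  induction h.terminates with
  | intro c _ ih =>
    by_cases hc : c.state ∈ M.halt
    · rw [M.value_of_halt _ hc, M.value_of_halt _ hc]
      by_cases ha : c.state ∈ M.acc
      · have : c.state ∉ M.rej := fun hr => M.disjoint_acc_rej.le_bot ⟨ha, hr⟩
        simp [verdict, ha, this]
      · have : c.state ∈ M.rej := hc.resolve_left ha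
        simp [verdict, ha, this]
    · rw [M.value_of_not_halt _ hc, M.value_of_not_halt _ hc, ← PPDACore.next_add,
        M.next_congr (V' := fun _ => 1) fun d hd => ih d hd (h.step hd)]
      exact M.next_one_eq hc h

theorem value_le_one {c : Config (Tape A) Q Γ} (h : M.Reachable c) (β : Bool) :
    M.value β c ≤ 1 := by
  rw [← M.value_add_value h]
  cases β
  · exact le_add_self
  · exact le_self_add

open Classical in
/-- The weights defining `popValue`. -/
noncomputable def popFinal (v : Q → ℝ≥0∞) (c : Config (Tape A) Q Γ) : ℝ≥0∞ :=
  if c.state ∈ M.halt then (if c.state ∈ M.acc then 1 else 0)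
  else if c.stack = [] then v c.state else 0

/-- The acceptance probability of a computation that is started in `c` and, if it empties the
stack in the non-halting state `p`, accepts with probability `v p`. -/
noncomputable def popValue (v : Q → ℝ≥0∞) (c : Config (Tape A) Q Γ) : ℝ≥0∞ :=
  M.allPathSum (M.popFinal v) c

/-- The bound is needed for all annotations, including configurations that are never reached, so it
rests on `allPathSum_le_one` and not on termination. -/
theorem popValue_le_one {v : Q → ℝ≥0∞} (hv : ∀ q, v q ≤ 1) (c : Config (Tape A) Q Γ) :
    M.popValue v c ≤ 1 := by
  refine M.allPathSum_le_one (fun c => ?_) c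
  unfold popFinal
  split_ifs with h1 h2 h3
  · simp [M.next_eq_zero_of_halt _ h1]
  · simp [M.next_eq_zero_of_halt _ h1]
  · obtain ⟨q, x, w⟩ := c
    simp only at h3
    subst h3
    simpa [PPDACore.next] using hv q
  · simpa using M.next_one_le c

open Classical in
theorem popValue_of_halt (v : Q → ℝ≥0∞) {c : Config (Tape A) Q Γ} (hc : c.state ∈ M.halt) :
    M.popValue v c = if c.state ∈ M.acc then 1 else 0 := by
  rw [popValue, PPDACore.allPathSum_eq, M.next_eq_zero_of_halt _ hc, add_zero, popFinal,
    if_pos hc]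

theorem popValue_nil (v : Q → ℝ≥0∞) {q : Q} (hq : q ∉ M.halt) (x : List (Tape A)) :
    M.popValue v ⟨q, x, []⟩ = v q := by
  rw [popValue, PPDACore.allPathSum_eq, popFinal]
  simp [hq, PPDACore.next]

theorem popValue_cons (v : Q → ℝ≥0∞) {q : Q} (hq : q ∉ M.halt) (x : List (Tape A)) (a : Γ)
    (w : List Γ) : M.popValue v ⟨q, x, a :: w⟩ = M.next (M.popValue v) ⟨q, x, a :: w⟩ := by
  conv_lhs => rw [popValue, PPDACore.allPathSum_eq, popFinal]
  simp only [hq, if_false, reduceCtorEq, zero_add]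
  rfl

/-- If random functions `v` have means equal to the acceptance probabilities with stack `w`, then
the acceptance probabilities with stack `t ++ w` are the means of the values `popValue`. -/
theorem map_popValue {X : Type*} (L : (X → ℝ≥0∞) →ₗ[ℝ≥0∞] ℝ≥0∞) (hL : L (fun _ => 1) = 1)
    (v : X → Q → ℝ≥0∞) {w : List Γ}
    (hv : ∀ q ∉ M.halt, M.Reachable ⟨q, [], w⟩ → L (fun x => v x q) = M.value true ⟨q, [], w⟩)
    {q : Q} {t : List Γ} (h : M.Reachable ⟨q, [], t ++ w⟩) :
    L (fun x => M.popValue (v x) ⟨q, [], t⟩) = M.value true ⟨q, [], t ++ w⟩ := by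
  generalize hc : (⟨q, [], t ++ w⟩ : Config (Tape A) Q Γ) = c at h
  have hterm := h.terminates
  induction hterm generalizing q t with
  | intro c _ ih =>
    subst hc
    by_cases hq : q ∈ M.halt
    · simp only [M.popValue_of_halt _ (c := ⟨q, [], t⟩) hq,
        M.value_of_halt true (c := ⟨q, [], t ++ w⟩) hq, verdict, cond_true]
      by_cases ha : q ∈ M.acc
      · simpa [ha] using hL
      · simp only [ha, if_false]
        exact map_zero L
    rcases t with _ | ⟨a, t⟩
    -- The only place where `v` enters, and it enters linearly: the joint law of the verdicts is
    -- irrelevant.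
    · simp only [M.popValue_nil _ hq]
      exact hv q hq h
    · simp only [M.popValue_cons _ hq]
      rw [M.value_of_not_halt true (c := ⟨q, [], a :: t ++ w⟩) hq]
      simp only [PPDACore.next, List.cons_append, PPDACore.map_moveSum]
      refine M.moveSum_congr fun p u hu => ?_
      have hs : M.Step ⟨q, [], a :: t ++ w⟩ ⟨p, [], u ++ t ++ w⟩ := by
        simpa using PPDACore.Step.lam (M := M.toPPDACore) q [] a (t ++ w) p u hu
      rw [← List.append_assoc]
      exact ih _ hs rfl (h.step hs)

/-! ### The phase before the first input symbol has been read -/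

section FirstPhase

/-- The weights defining `firstSum`. -/
noncomputable def firstRead (σ : A) (K : Q → List Γ → ℝ≥0∞) : Config (Tape A) Q Γ → ℝ≥0∞
  | ⟨q, [], a :: w⟩ => M.moveSum q (some (Tape.sym σ)) a fun p u => K p (u ++ w)
  | _ => 0

open Classical in
/-- The weights defining `firstSum`, including those of the halting states. -/
noncomputable def firstFinal (σ : A) (K : Q → List Γ → ℝ≥0∞) (c : Config (Tape A) Q Γ) : ℝ≥0∞ :=
  if c.state ∈ M.halt then K c.state c.stack else M.firstRead σ K c

/-- The expectation of `K` (a function of state and stack) at the time when the machine, started in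
`c`, has halted or has read the additional symbol `σ`. -/
noncomputable def firstSum (σ : A) (K : Q → List Γ → ℝ≥0∞) (c : Config (Tape A) Q Γ) : ℝ≥0∞ :=
  M.allPathSum (M.firstFinal σ K) c

/-- The initial configuration on a region that only contains the left endmarker. -/
def start : Config (Tape A) Q Γ := ⟨M.q₀, [Tape.left], [M.Z₀]⟩

variable {M}

theorem start_cases {c : Config (Tape A) Q Γ} (h : Relation.ReflTransGen M.Step M.start c) :
    c = M.start ∨ ∃ p u, 0 < M.δ M.q₀ (some Tape.left) M.Z₀ p u ∧ c.input = [] ∧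
      Relation.ReflTransGen M.Step ⟨p, [], u⟩ c := by
  rcases h.cases_head with h | ⟨d, hd, hdc⟩
  · exact .inl h.symm
  · right
    rw [start] at hd
    cases hd with
    | lam _ _ _ _ p u hu =>
      exfalso
      have h0 := M.total_init
      simp only [PPDACore.total, Finset.sum_eq_zero_iff] at h0
      exact hu.ne' (h0 p (Finset.mem_univ _) u (M.mem_of_pos hu))
    | read _ _ _ _ _ p u hu =>
      rw [List.append_nil] at hdc
      exact ⟨p, u, hu, PPDACore.input_eq_nil_of_reflTransGen hdc rfl, hdc⟩

theorem reachable_extend_start {c : Config (Tape A) Q Γ}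
    (h : Relation.ReflTransGen M.Step M.start c) (x : List A) :
    M.Reachable (c.extend (x.map Tape.sym ++ [Tape.right]) []) :=
  ⟨x, PPDACore.reflTransGen_extend h _ _⟩

theorem terminates_of_start {c : Config (Tape A) Q Γ}
    (h : Relation.ReflTransGen M.Step M.start c) : M.Terminates c :=
  (reachable_extend_start h []).terminates.of_extend

theorem stackOK_of_start {c : Config (Tape A) Q Γ}
    (h : Relation.ReflTransGen M.Step M.start c) : M.StackOK c.stack := by
  simpa [Config.extend] using (reachable_extend_start h []).stackOK

/-- The move on the left endmarker leaves at most `pushSize` symbols; the height bound controls the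
λ-moves after it. -/
theorem length_le_of_start [Fintype Γ] {c : Config (Tape A) Q Γ}
    (h : Relation.ReflTransGen M.Step M.start c) :
    c.stack.length ≤
      M.pushSize + M.pushSize * (Fintype.card Q * Fintype.card Γ) := by
  rcases start_cases h with rfl | ⟨p, u, hu, hc, hpc⟩
  · have := M.pushSize_spec.1
    simp only [start, List.length_singleton]
    omega
  · obtain ⟨q, x, w⟩ := c
    simp only at hc
    subst hc
    have hs : M.Step M.start ⟨p, [], u⟩ := by
      simpa [start] using PPDACore.Step.read (M := M.toPPDACore) M.q₀ Tape.left [] M.Z₀ [] p u hu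
    have := PPDACore.length_le_of_terminates (terminates_of_start (.single hs)) hpc
    have := M.length_le_pushSize hu
    simp only
    omega

/-- A function on configurations that is harmonic until the first input symbol has been read is
determined by its values at that time. -/
theorem firstSum_eq (σ : A) (y : List (Tape A)) {K : Q → List Γ → ℝ≥0∞}
    {V : Config (Tape A) Q Γ → ℝ≥0∞}
    (hhalt : ∀ c, Relation.ReflTransGen M.Step M.start c → c.state ∈ M.halt →
      K c.state c.stack = V (c.extend (Tape.sym σ :: y) []))
    (hread : ∀ q a w p u, Relation.ReflTransGen M.Step M.start ⟨q, [], a :: w⟩ →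
      0 < M.δ q (some (Tape.sym σ)) a p u → K p (u ++ w) = V ⟨p, y, u ++ w⟩)
    (hV : ∀ c, Relation.ReflTransGen M.Step M.start c → c.state ∉ M.halt →
      V (c.extend (Tape.sym σ :: y) []) = M.next V (c.extend (Tape.sym σ :: y) []))
    {c : Config (Tape A) Q Γ} (h : Relation.ReflTransGen M.Step M.start c) :
    M.firstSum σ K c = V (c.extend (Tape.sym σ :: y) []) := by
  induction terminates_of_start h with
  | intro c _ ih =>
    have hrec : M.firstSum σ K c = M.firstFinal σ K c + M.next (M.firstSum σ K) c :=
      M.allPathSum_eq _ _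
    rw [hrec]
    by_cases hc : c.state ∈ M.halt
    · rw [M.next_eq_zero_of_halt _ hc, add_zero, firstFinal, if_pos hc, hhalt c h hc]
    rw [firstFinal, if_neg hc, hV c h hc,
      M.next_congr (V' := fun d => V (d.extend (Tape.sym σ :: y) []))
        fun d hd => ih d hd (h.tail hd)]
    have hne := (stackOK_of_start h).ne_nil
    have hinput : c.input = [] ∨ c.input = [Tape.left] := by
      rcases start_cases h with rfl | ⟨p, u, hu, hc, hpc⟩
      · exact .inr rfl
      · exact .inl hc
    obtain ⟨q, x, w⟩ := c
    rcases w with _ | ⟨a, w⟩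
    · exact absurd rfl hne
    simp only at hinput
    rcases hinput with rfl | rfl
    · simp only [firstRead, PPDACore.next, Config.extend, List.append_nil, List.nil_append]
      rw [add_comm]
      congr 1
      exact M.moveSum_congr fun p u hu => hread q a w p u h hu
    · simp only [firstRead, PPDACore.next, Config.extend, List.append_nil, List.nil_append,
        List.cons_append, zero_add]

/-- The constant function is harmonic as long as the machine has not halted, so the first phase ends
with total mass one. -/
theorem firstSum_one (σ : A) : M.firstSum σ (fun _ _ => 1) M.start = 1 := by
  refine firstSum_eq σ [Tape.right] (V := fun _ => 1) (fun _ _ _ => rfl)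
    (fun _ _ _ _ _ _ _ => rfl) (fun c h hc => ?_) .refl
  exact (M.next_one_eq (c := c.extend _ _) hc (reachable_extend_start h [σ])).symm

theorem firstSum_sum_mul {ι : Type*} (I : Finset ι) (σ : A) (k : ι → ℝ≥0∞)
    (K : ι → Q → List Γ → ℝ≥0∞) (c : Config (Tape A) Q Γ) :
    M.firstSum σ (fun p w => ∑ i ∈ I, k i * K i p w) c =
      ∑ i ∈ I, k i * M.firstSum σ (K i) c := by
  unfold firstSum
  rw [← PPDACore.allPathSum_sum_mul]
  congr 1
  ext d
  unfold firstFinal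
  split_ifs
  · rfl
  · obtain ⟨q, x, w⟩ := d
    rcases w with _ | ⟨a, w⟩
    · simp [firstRead]
    rcases x with _ | ⟨τ, x⟩
    · simp only [firstRead, PPDACore.moveSum_sum, PPDACore.moveSum_const_mul]
    · simp [firstRead]

/-- What the weights `firstSum` record is reachable. -/
theorem exists_of_firstSum_ne_zero {σ : A} {K : Q → List Γ → ℝ≥0∞}
    (h : M.firstSum σ K M.start ≠ 0) :
    ∃ p w, K p w ≠ 0 ∧ M.StackOK w ∧
      (p ∈ M.halt ∧ (∃ c, Relation.ReflTransGen M.Step M.start c ∧ c.stack = w) ∨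
      ∃ q a t u, Relation.ReflTransGen M.Step M.start ⟨q, [], a :: t⟩ ∧
        0 < M.δ q (some (Tape.sym σ)) a p u ∧ w = u ++ t) := by
  obtain ⟨c, hc, hne⟩ := M.exists_reflTransGen_of_allPathSum_ne_zero h
  unfold firstFinal at hne
  split_ifs at hne with hh
  · exact ⟨c.state, c.stack, hne, stackOK_of_start hc, .inl ⟨hh, c, hc, rfl⟩⟩
  · obtain ⟨q, x, w⟩ := c
    rcases w with _ | ⟨a, t⟩
    · simp [firstRead] at hne
    rcases x with _ | ⟨τ, x⟩
    · simp only [firstRead] at hne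
      by_contra hcon
      push Not at hcon
      refine hne ?_
      rw [M.moveSum_congr (H' := fun _ _ => 0)]
      · simp [PPDACore.moveSum]
      intro p u hu
      by_contra hK
      exact (hcon p (u ++ t) hK ((stackOK_of_start hc).replace hu)).2 q a t u hc hu rfl
    · simp [firstRead] at hne

end FirstPhase

end EndmarkerPPDA

/-! ### Independent random bits -/

section Bernoulli

/-- The weight of `b` under a Bernoulli distribution with parameter `v`. -/
noncomputable def bernoulliWeight (v : ℝ≥0∞) (b : Bool) : ℝ≥0∞ := cond b v (1 - v)

theorem bernoulliWeight_le_one {v : ℝ≥0∞} (hv : v ≤ 1) (b : Bool) : bernoulliWeight v b ≤ 1 := by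
  cases b
  · exact tsub_le_self
  · exact hv

theorem sum_bernoulliWeight {v : ℝ≥0∞} (hv : v ≤ 1) : ∑ b, bernoulliWeight v b = 1 := by
  simp [bernoulliWeight, add_tsub_cancel_of_le hv]

variable {Q : Type*} [Fintype Q]

/-- The weight of `g` under the product of Bernoulli distributions with parameters `v q`. -/
noncomputable def productWeight (v : Q → ℝ≥0∞) (g : Q → Bool) : ℝ≥0∞ :=
  ∏ q, bernoulliWeight (v q) (g q)

theorem productWeight_le_one {v : Q → ℝ≥0∞} (hv : ∀ q, v q ≤ 1) (g : Q → Bool) :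
    productWeight v g ≤ 1 :=
  Finset.prod_le_one (fun _ _ => zero_le) fun q _ => bernoulliWeight_le_one (hv q) _

open Classical in
theorem sum_productWeight {v : Q → ℝ≥0∞} (hv : ∀ q, v q ≤ 1) :
    ∑ g : Q → Bool, productWeight v g = 1 := by
  simp only [productWeight]
  rw [← Fintype.prod_sum]
  exact Finset.prod_eq_one fun q _ => sum_bernoulliWeight (hv q)

-- The indicator of `g q` is a product with one nontrivial factor, so the sum factors over the
-- coordinates, and all coordinates but `q` contribute one.
open Classical in
theorem sum_productWeight_mul {v : Q → ℝ≥0∞} (hv : ∀ q, v q ≤ 1) (q : Q) :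
    (∑ g : Q → Bool, productWeight v g * if g q then 1 else 0) = v q := by
  have h : ∀ g : Q → Bool, (productWeight v g * if g q then 1 else 0) =
      ∏ p, bernoulliWeight (v p) (g p) * if p = q then (if g p then 1 else 0) else 1 := by
    intro g
    rw [Finset.prod_mul_distrib, productWeight]
    congr 1
    simp
  simp only [h]
  rw [← Fintype.prod_sum (fun p b => bernoulliWeight (v p) b *
    if p = q then (if b then (1 : ℝ≥0∞) else 0) else 1), Finset.prod_eq_single q]
  · simp [bernoulliWeight]
  · intro p _ hp
    simpa [hp, -Fintype.univ_bool] using sum_bernoulliWeight (hv p)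
  · simp

end Bernoulli

theorem Finsupp.exists_of_sum_single_pos {ι α : Type*} {I : Finset ι} {t : ι → α} {w : ι → ℝ≥0}
    {y : α} (h : 0 < (∑ i ∈ I, Finsupp.single (t i) (w i)) y) :
    ∃ i ∈ I, t i = y ∧ 0 < w i := by
  classical
  rw [Finsupp.finsetSum_apply] at h
  obtain ⟨i, hi, h0⟩ := Finset.exists_ne_zero_of_sum_ne_zero h.ne'
  rw [Finsupp.single_apply] at h0
  split_ifs at h0 with hy
  · exact ⟨i, hi, hy, pos_iff_ne_zero.2 h0⟩
  · exact absurd rfl h0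

/-! ### States and transition law of the simulator -/

/-- The states of the simulating machine. In state `push q r`, the symbols of `r` are still to be
pushed, the first one first. In state `decided q b`, the machine has chosen the verdict `b` for the
case that the input ends here. -/
inductive SimState (Q Γ : Type*) (L : ℕ)
  | init : SimState Q Γ L
  | done : Bool → SimState Q Γ L
  | decided : Q → Bool → SimState Q Γ L
  | push : Q → {l : List Γ // l.length ≤ L} → SimState Q Γ L

namespace SimState

variable {Q Γ : Type*} {L : ℕ}

/-- An encoding of the states that shows their number. -/
def encode : SimState Q Γ L → Unit ⊕ Bool ⊕ (Q × Bool) ⊕ (Q × (Fin L → Option Γ))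
  | init => .inl ()
  | done b => .inr (.inl b)
  | decided q b => .inr (.inr (.inl (q, b)))
  | push q r => .inr (.inr (.inr (q, fun i => r.1[(i : ℕ)]?)))

theorem encode_injective : Function.Injective (encode : SimState Q Γ L → _) := by
  intro x y h
  cases x <;> cases y <;> simp [encode] at h ⊢
  · exact h
  · exact h
  · rename_i q r q' r'
    refine ⟨h.1, Subtype.ext (List.ext_getElem? fun i => ?_)⟩
    by_cases hi : i < L
    · exact congrFun h.2 ⟨i, hi⟩
    · rw [List.getElem?_eq_none (by have := r.2; omega),
        List.getElem?_eq_none (by have := r'.2; omega)]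

noncomputable instance [Fintype Q] [Fintype Γ] : Fintype (SimState Q Γ L) :=
  Fintype.ofInjective encode encode_injective

/-- Padding the lists with `none` gives the power of `m + 1`; the `3` counts `init` and the two
`done` states. -/
theorem card_le [Fintype Q] [Fintype Γ] : Fintype.card (SimState Q Γ L) ≤
    3 + 2 * Fintype.card Q + Fintype.card Q * (Fintype.card Γ + 1) ^ L := by
  refine (Fintype.card_le_of_injective _ encode_injective).trans (le_of_eq ?_)
  simp
  ring

end SimState

noncomputable instance {Γ : Type*} [Fintype Γ] {L : ℕ} : Fintype {l : List Γ // l.length ≤ L} :=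
  (List.finite_length_le Γ L).fintype

namespace EndmarkerPPDA

variable {A Q Γ : Type*} [Fintype Q] (M : EndmarkerPPDA A Q Γ)

/-- The acceptance probability with topmost symbol `a.1`, if `a.2` tells the verdicts for the stack
below. -/
noncomputable def annotatedValue (a : Γ × (Q → Bool)) (q : Q) : ℝ≥0∞ :=
  M.popValue (fun p => if a.2 p then 1 else 0) ⟨q, [], [a.1]⟩

/-- The probability of reading the right endmarker and accepting afterwards. -/
noncomputable def endValue (a : Γ × (Q → Bool)) (q : Q) : ℝ≥0∞ :=
  M.moveSum q (some Tape.right) a.1 fun p u =>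
    M.popValue (fun p => if a.2 p then 1 else 0) ⟨p, [], u⟩

open Classical in
/-- The probability of deciding for the verdict `b`. -/
noncomputable def decideWeight (q : Q) (a : Γ × (Q → Bool)) (b : Bool) : ℝ≥0∞ :=
  if q ∈ M.halt then (if q ∈ M.verdict b then 1 else 0)
  else bernoulliWeight (M.endValue a q / M.total q (some Tape.right) a.1) b

theorem annotatedValue_le_one (a : Γ × (Q → Bool)) (q : Q) : M.annotatedValue a q ≤ 1 :=
  M.popValue_le_one (fun p => by split_ifs <;> simp) _

theorem endValue_le (a : Γ × (Q → Bool)) (q : Q) :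
    M.endValue a q ≤ M.total q (some Tape.right) a.1 := by
  rw [← M.moveSum_one]
  exact M.moveSum_mono fun p u => M.popValue_le_one (fun p => by split_ifs <;> simp) _

theorem endValue_div_le_one (a : Γ × (Q → Bool)) (q : Q) :
    M.endValue a q / M.total q (some Tape.right) a.1 ≤ 1 :=
  ENNReal.div_le_of_le_mul (by simpa using M.endValue_le a q)

/-- When the endmarker move has probability zero the quotient is meaningless, but then `endValue`
vanishes as well. -/
theorem total_mul_endValue_div (a : Γ × (Q → Bool)) (q : Q) :
    M.total q (some Tape.right) a.1 * (M.endValue a q / M.total q (some Tape.right) a.1) =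
      M.endValue a q := by
  refine ENNReal.mul_div_cancel' (fun h => ?_) (fun h => absurd h ENNReal.coe_ne_top)
  have := M.endValue_le a q
  rw [h] at this
  exact le_antisymm this zero_le

theorem decideWeight_le_one (q : Q) (a : Γ × (Q → Bool)) (b : Bool) :
    M.decideWeight q a b ≤ 1 := by
  unfold decideWeight
  split_ifs
  · exact le_rfl
  · exact zero_le_one
  · exact bernoulliWeight_le_one (M.endValue_div_le_one a q) b

theorem sum_decideWeight (q : Q) (a : Γ × (Q → Bool)) : ∑ b, M.decideWeight q a b = 1 := by
  unfold decideWeight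
  split_ifs with h
  · by_cases ha : q ∈ M.acc
    · have : q ∉ M.rej := fun hr => M.disjoint_acc_rej.le_bot ⟨ha, hr⟩
      simp [verdict, ha, this]
    · have : q ∈ M.rej := h.resolve_left ha
      simp [verdict, ha, this]
  · exact sum_bernoulliWeight (M.endValue_div_le_one a q)

variable [Fintype Γ]

/-- A bound for the number of symbols that the simulation pushes in one go. -/
noncomputable def simBound : ℕ := 3 * M.pushSize * Fintype.card Q * Fintype.card Γ

/-- The states of the simulating machine for `M`. -/
abbrev Sim : Type _ := SimState Q Γ M.simBound

/-- The state in which the symbols of `r` are to be pushed, cut off at the admissible length. -/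
noncomputable def Sim.pushList (M : EndmarkerPPDA A Q Γ) (q : Q) (r : List Γ) : M.Sim :=
  .push q ⟨r.take M.simBound, List.length_take_le _ _⟩

/-- The bottom marker of the simulating machine. -/
def simBottom : Γ × (Q → Bool) := (M.Z₀, fun _ => false)

/-- Replacing the topmost symbol by the last symbol of `u`. -/
def replaceTop (a : Γ × (Q → Bool)) (u : List Γ) : List (Γ × (Q → Bool)) :=
  (u.getLast?.map fun b => (b, a.2)).toList

open Classical in
/-- The probability that `M` has halted or has read the first input symbol `σ` in the situation
that the simulating machine represents by the state `push x.1 x.2`. -/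
noncomputable def firstWeight (σ : A) (x : Q × {l : List Γ // l.length ≤ M.simBound}) : ℝ≥0∞ :=
  M.firstSum σ
    (fun p w => if Sim.pushList M p w.dropLast.reverse = .push x.1 x.2 then 1 else 0) M.start

open Classical in
/-- The transition probabilities of the simulating machine. -/
noncomputable def simLaw :
    M.Sim → Option A → Γ × (Q → Bool) → M.Sim × List (Γ × (Q → Bool)) →₀ ℝ≥0
  | .init, some σ, a =>
      -- One move stands for the run of `M` until it has halted or has read the first symbol.
      if a = M.simBottom then
        ∑ x, Finsupp.single (.push x.1 x.2, [M.simBottom]) (M.firstWeight σ x).toNNReal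
      -- Never reached; the probability requirement covers this pair all the same.
      else Finsupp.single (.done false, [a]) 1
  | .init, none, a =>
      if a = M.simBottom then
        ∑ b, Finsupp.single (.done b, [M.simBottom])
          (M.value b ⟨M.q₀, Tape.region [], [M.Z₀]⟩).toNNReal
      else 0
  | .done b, some _, a => Finsupp.single (.done b, [a]) 1
  | .done _, none, _ => 0
  | .decided q b, s, a =>
      -- `M` has halted: the rest of the input is consumed with the verdict fixed.
      if q ∈ M.halt then s.elim 0 fun _ => Finsupp.single (.decided q b, [a]) 1
      -- The bit `b` has no influence on the move. The lowest new symbol inherits the annotation of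
      -- `a`, since the stack below is unchanged.
      else ∑ x ∈ Finset.univ ×ˢ M.Θ,
        Finsupp.single (Sim.pushList M x.1 x.2.dropLast.reverse, replaceTop a x.2)
          (M.δ q (s.map Tape.sym) a.1 x.1 x.2)
  | .push q ⟨[], _⟩, none, a =>
      ∑ b, Finsupp.single (.decided q b, [a]) (M.decideWeight q a b).toNNReal
  | .push q ⟨c :: r, h⟩, none, a =>
      -- A filler that prevents writing a bottom marker; it does not occur on actual runs.
      if c = M.Z₀ then Finsupp.single (.push q ⟨r, (Nat.le_succ _).trans h⟩, [a]) 1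
      else ∑ g : Q → Bool,
        Finsupp.single (.push q ⟨r, (Nat.le_succ _).trans h⟩, [(c, g), a])
          (productWeight (M.annotatedValue a) g).toNNReal
  | .push _ _, some _, _ => 0

variable {M}

theorem simLaw_decided_pos {q : Q} {b : Bool} (hq : q ∉ M.halt) {s : Option A}
    {a : Γ × (Q → Bool)} {p : M.Sim} {u : List (Γ × (Q → Bool))}
    (h : 0 < M.simLaw (.decided q b) s a (p, u)) :
    ∃ p' u', 0 < M.δ q (s.map Tape.sym) a.1 p' u' ∧
      p = Sim.pushList M p' u'.dropLast.reverse ∧ u = replaceTop a u' := by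
  rw [simLaw, if_neg hq] at h
  obtain ⟨x, -, hx, hpos⟩ := Finsupp.exists_of_sum_single_pos h
  simp only [Prod.mk.injEq] at hx
  exact ⟨x.1, x.2, hpos, hx.1.symm, hx.2.symm⟩

theorem simLaw_decided_halt_pos {q : Q} {b : Bool} (hq : q ∈ M.halt) {s : Option A}
    {a : Γ × (Q → Bool)} {p : M.Sim} {u : List (Γ × (Q → Bool))}
    (h : 0 < M.simLaw (.decided q b) s a (p, u)) :
    s ≠ none ∧ p = .decided q b ∧ u = [a] := by
  classical
  rw [simLaw, if_pos hq] at h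
  cases s
  · simp at h
  · simp only [Option.elim_some, Finsupp.single_apply] at h
    split_ifs at h with hx
    · simp only [Prod.mk.injEq] at hx
      exact ⟨by simp, hx.1.symm, hx.2.symm⟩
    · simp at h

theorem simLaw_done_pos {b : Bool} {s : Option A}
    {a : Γ × (Q → Bool)} {p : M.Sim} {u : List (Γ × (Q → Bool))}
    (h : 0 < M.simLaw (.done b) s a (p, u)) :
    s ≠ none ∧ p = .done b ∧ u = [a] := by
  classical
  cases s
  · simp [simLaw] at h
  · simp only [simLaw, Finsupp.single_apply] at h
    split_ifs at h with hx
    · simp only [Prod.mk.injEq] at hx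
      exact ⟨by simp, hx.1.symm, hx.2.symm⟩
    · simp at h

theorem simLaw_push_nil_pos {q : Q} {hr : ([] : List Γ).length ≤ M.simBound} {s : Option A}
    {a : Γ × (Q → Bool)} {p : M.Sim} {u : List (Γ × (Q → Bool))}
    (h : 0 < M.simLaw (.push q ⟨[], hr⟩) s a (p, u)) :
    s = none ∧ (∃ b, p = .decided q b) ∧ u = [a] := by
  cases s
  · rw [simLaw] at h
    obtain ⟨b, -, hx, -⟩ := Finsupp.exists_of_sum_single_pos h
    simp only [Prod.mk.injEq] at hx
    exact ⟨rfl, ⟨b, hx.1.symm⟩, hx.2.symm⟩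
  · simp [simLaw] at h

theorem simLaw_push_cons_pos {q : Q} {c : Γ} {r : List Γ}
    {hr : (c :: r).length ≤ M.simBound} {s : Option A}
    {a : Γ × (Q → Bool)} {p : M.Sim} {u : List (Γ × (Q → Bool))}
    (h : 0 < M.simLaw (.push q ⟨c :: r, hr⟩) s a (p, u)) :
    s = none ∧ p = .push q ⟨r, (Nat.le_succ _).trans hr⟩ ∧
      (c = M.Z₀ ∧ u = [a] ∨ c ≠ M.Z₀ ∧ ∃ g, u = [(c, g), a]) := by
  classical
  cases s
  · rw [simLaw] at h
    split_ifs at h with hc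
    · rw [Finsupp.single_apply] at h
      split_ifs at h with hx
      · simp only [Prod.mk.injEq] at hx
        exact ⟨rfl, hx.1.symm, .inl ⟨hc, hx.2.symm⟩⟩
      · simp at h
    · obtain ⟨b, -, hx, -⟩ := Finsupp.exists_of_sum_single_pos h
      simp only [Prod.mk.injEq] at hx
      exact ⟨rfl, hx.1.symm, .inr ⟨hc, b, hx.2.symm⟩⟩
  · simp [simLaw] at h

theorem simLaw_init_bottom_pos {s : Option A} {p : M.Sim} {u : List (Γ × (Q → Bool))}
    (h : 0 < M.simLaw .init s M.simBottom (p, u)) :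
    u = [M.simBottom] ∧ ((s = none ∧ ∃ b, p = .done b) ∨
      ∃ σ x, s = some σ ∧ p = .push x.1 x.2 ∧ M.firstWeight σ x ≠ 0) := by
  cases s
  · rw [simLaw, if_pos rfl] at h
    obtain ⟨b, -, hx, -⟩ := Finsupp.exists_of_sum_single_pos h
    simp only [Prod.mk.injEq] at hx
    exact ⟨hx.2.symm, .inl ⟨rfl, b, hx.1.symm⟩⟩
  · rename_i σ
    rw [simLaw, if_pos rfl] at h
    obtain ⟨b, -, hx, hpos⟩ := Finsupp.exists_of_sum_single_pos h
    simp only [Prod.mk.injEq] at hx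
    refine ⟨hx.2.symm, .inr ⟨σ, b, rfl, hx.1.symm, fun h0 => ?_⟩⟩
    simp [h0] at hpos

theorem simLaw_init_pos {s : Option A} {a : Γ × (Q → Bool)} (ha : a ≠ M.simBottom) {p : M.Sim}
    {u : List (Γ × (Q → Bool))} (h : 0 < M.simLaw .init s a (p, u)) :
    p = .done false ∧ u = [a] := by
  classical
  cases s
  · simp [simLaw, ha] at h
  · rw [simLaw, if_neg ha, Finsupp.single_apply] at h
    split_ifs at h with hx
    · simp only [Prod.mk.injEq] at hx
      exact ⟨hx.1.symm, hx.2.symm⟩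
    · simp at h

/-- The possible shapes of the moves of the simulating machine. -/
theorem simLaw_shape {q p : M.Sim} {s : Option A} {a : Γ × (Q → Bool)}
    {u : List (Γ × (Q → Bool))} (h : 0 < M.simLaw q s a (p, u)) :
    p ≠ .init ∧ ((u = [] ∧ a ≠ M.simBottom) ∨
      (∃ b, u = [b] ∧ (b = M.simBottom ↔ a = M.simBottom)) ∨
      ∃ b, u = [b, a] ∧ b ≠ M.simBottom) := by
  rcases q with _ | b | ⟨q, b⟩ | ⟨q, r, hr⟩
  · by_cases ha : a = M.simBottom
    · subst ha
      obtain ⟨rfl, ⟨-, b, rfl⟩ | ⟨σ, x, -, rfl, -⟩⟩ := simLaw_init_bottom_pos h <;> simp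
    · obtain ⟨rfl, rfl⟩ := simLaw_init_pos ha h
      simp
  · obtain ⟨-, rfl, rfl⟩ := simLaw_done_pos h
    simp
  · by_cases hq : q ∈ M.halt
    · obtain ⟨-, rfl, rfl⟩ := simLaw_decided_halt_pos hq h
      simp
    · obtain ⟨p', u', hpos, rfl, rfl⟩ := simLaw_decided_pos hq h
      refine ⟨by simp [Sim.pushList], ?_⟩
      rcases List.eq_nil_or_concat u' with rfl | ⟨v, b, rfl⟩
      · refine .inl ⟨rfl, ?_⟩
        rintro rfl
        obtain ⟨v, -, hv⟩ := M.δ_of_eq _ _ _ _ hpos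
        simp at hv
      · refine .inr (.inl ⟨(b, a.2), by simp [replaceTop], ?_⟩)
        obtain ⟨a, g⟩ := a
        simp only [simBottom, Prod.mk.injEq, and_congr_left_iff]
        rintro -
        constructor
        · rintro rfl
          by_contra ha
          exact M.δ_of_ne _ _ _ _ _ hpos ha (by simp)
        · rintro rfl
          obtain ⟨v', -, hv⟩ := M.δ_of_eq _ _ _ _ hpos
          rw [List.concat_eq_append] at hv
          simpa using (List.append_inj' hv rfl).2
  · rcases r with _ | ⟨c, r⟩
    · obtain ⟨-, ⟨b, rfl⟩, rfl⟩ := simLaw_push_nil_pos h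
      simp
    · obtain ⟨-, rfl, ⟨-, rfl⟩ | ⟨hc, g, rfl⟩⟩ := simLaw_push_cons_pos h
      · simp
      · refine ⟨by simp, .inr (.inr ⟨(c, g), rfl, ?_⟩)⟩
        simp [simBottom, hc]

variable (M)

/-- The simulating machine, without the proofs of the requirements on probabilities. -/
noncomputable def simCore : PPDACore A M.Sim (Γ × (Q → Bool)) where
  Θ := (List.finite_length_le (Γ × (Q → Bool)) 2).toFinset
  nil_mem := by simp
  δ q s a p u := M.simLaw q s a (p, u)
  q₀ := .init
  Z₀ := M.simBottom
  acc := {q | ∃ b, (q = .done b ∨ ∃ p, q = .decided p b) ∧ b = true}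
  -- The states `init` and `push` are put here because every state needs a verdict. No halting
  -- probability arises from this: the λ-moves of `push` states, and those of `init` on the bottom
  -- marker, have total one.
  rej := {q | ¬ ∃ b, (q = .done b ∨ ∃ p, q = .decided p b) ∧ b = true}
  disjoint_acc_rej := disjoint_compl_right
  δ_eq_zero_of_notMem q s a p u hu := by
    by_contra h
    obtain ⟨-, ⟨rfl, -⟩ | ⟨b, rfl, -⟩ | ⟨b, rfl, -⟩⟩ := simLaw_shape (pos_iff_ne_zero.2 h) <;>
      simp at hu
  δ_of_ne q s a p u h ha := by
    obtain ⟨-, ⟨rfl, -⟩ | ⟨b, rfl, hb⟩ | ⟨b, rfl, hb⟩⟩ := simLaw_shape h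
    · simp
    · simpa [eq_comm] using fun h => ha (hb.1 h)
    · simp [Ne.symm ha, Ne.symm hb]
  δ_of_eq q s p u h := by
    obtain ⟨-, ⟨rfl, hb⟩ | ⟨b, rfl, hb⟩ | ⟨b, rfl, hb⟩⟩ := simLaw_shape h
    · exact absurd rfl hb
    · exact ⟨[], by simp, by simpa using hb⟩
    · exact ⟨[b], by simpa using Ne.symm hb, rfl⟩

theorem simCore_pushesSingleSymbols : M.simCore.PushesSingleSymbols := by
  refine ⟨fun u hu => by simpa [simCore] using hu, fun q s a p u h => ?_⟩
  obtain ⟨-, ⟨rfl, -⟩ | ⟨b, rfl, -⟩ | ⟨b, rfl, -⟩⟩ := simLaw_shape h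
  · exact .inl rfl
  · exact .inr (.inl ⟨b, rfl⟩)
  · exact .inr (.inr ⟨b, rfl⟩)

/-- As `simLaw` is a sum of point masses, linearity evaluates expectations term by term, even if
several terms share a target. -/
theorem simCore_moveSum (q : M.Sim) (s : Option A) (a : Γ × (Q → Bool))
    (H : M.Sim → List (Γ × (Q → Bool)) → ℝ≥0∞) :
    M.simCore.moveSum q s a H =
      Finsupp.linearCombination ℝ≥0 (fun x : M.Sim × List (Γ × (Q → Bool)) => H x.1 x.2)
        (M.simLaw q s a) := by
  classical
  rw [Finsupp.linearCombination_apply, Finsupp.sum_of_support_subset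
    (s := Finset.univ ×ˢ M.simCore.Θ), Finset.sum_product]
  · rfl
  · intro x hx
    rw [Finsupp.mem_support_iff] at hx
    simp only [Finset.mem_product, Finset.mem_univ, true_and]
    exact M.simCore.mem_of_pos (q := q) (s := s) (a := a) (p := x.1) (pos_iff_ne_zero.2 hx)
  · simp

end EndmarkerPPDA

namespace EndmarkerPPDA

variable {A Q Γ : Type*} [Fintype Q] {M : EndmarkerPPDA A Q Γ}

/-- The symbols waiting in the state and the symbol already in place together spell the string that
`M` writes. -/
theorem dropLast_append_replaceTop {Q Γ : Type*} (a : Γ × (Q → Bool)) (u : List Γ) :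
    u.dropLast ++ (replaceTop a u).map Prod.fst = u := by
  rcases List.eq_nil_or_concat u with rfl | ⟨v, b, rfl⟩
  · rfl
  · simp [replaceTop]

theorem terminates_of_halt {c : Config (Tape A) Q Γ} (hc : c.state ∈ M.halt) :
    M.Terminates c := by
  refine Acc.intro _ fun d hd => ?_
  cases hd with
  | lam q _ a t p u h => simp [M.δ_halt _ hc] at h
  | read q _ _ a t p u h => simp [M.δ_halt _ hc] at h

theorem replaceTop_append_ne_nil {q : Q} {s : Option (Tape A)} {a : Γ × (Q → Bool)} {p : Q}
    {u w : List Γ} (hw : M.StackOK (a.1 :: w)) (h : 0 < M.δ q s a.1 p u) :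
    (replaceTop a u).map Prod.fst ++ w ≠ [] := by
  have := (hw.replace h).ne_nil
  rcases List.eq_nil_or_concat u with rfl | ⟨v, b, rfl⟩
  · simpa [replaceTop] using this
  · simp [replaceTop]

variable [Fintype Γ]

/-! ### Expectations over single moves of the simulator -/

section Moves

variable (M) (H : M.Sim → List (Γ × (Q → Bool)) → ℝ≥0∞)

theorem moveSum_done_none (b : Bool) (a : Γ × (Q → Bool)) :
    M.simCore.moveSum (.done b) none a H = 0 := by
  rw [simCore_moveSum, simLaw, map_zero]

theorem moveSum_done_some (b : Bool) (σ : A) (a : Γ × (Q → Bool)) :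
    M.simCore.moveSum (.done b) (some σ) a H = H (.done b) [a] := by
  rw [simCore_moveSum, simLaw]
  simp

theorem moveSum_decided_halt_none {q : Q} (hq : q ∈ M.halt) (b : Bool) (a : Γ × (Q → Bool)) :
    M.simCore.moveSum (.decided q b) none a H = 0 := by
  rw [simCore_moveSum, simLaw, if_pos hq]
  simp

theorem moveSum_decided_halt_some {q : Q} (hq : q ∈ M.halt) (b : Bool) (σ : A)
    (a : Γ × (Q → Bool)) :
    M.simCore.moveSum (.decided q b) (some σ) a H = H (.decided q b) [a] := by
  rw [simCore_moveSum, simLaw, if_pos hq]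
  simp

theorem moveSum_decided {q : Q} (hq : q ∉ M.halt) (b : Bool) (s : Option A)
    (a : Γ × (Q → Bool)) :
    M.simCore.moveSum (.decided q b) s a H = M.moveSum q (s.map Tape.sym) a.1
      fun p u => H (Sim.pushList M p u.dropLast.reverse) (replaceTop a u) := by
  rw [simCore_moveSum, simLaw, if_neg hq, map_sum, PPDACore.moveSum, Finset.sum_product]
  simp [ENNReal.smul_def]

theorem moveSum_push_some (q : Q) (r : {l : List Γ // l.length ≤ M.simBound}) (σ : A)
    (a : Γ × (Q → Bool)) : M.simCore.moveSum (.push q r) (some σ) a H = 0 := by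
  obtain ⟨_ | ⟨c, r⟩, hr⟩ := r <;> rw [simCore_moveSum, simLaw, map_zero]

theorem moveSum_push_nil (q : Q) (hr : ([] : List Γ).length ≤ M.simBound)
    (a : Γ × (Q → Bool)) : M.simCore.moveSum (.push q ⟨[], hr⟩) none a H =
      ∑ b, M.decideWeight q a b * H (.decided q b) [a] := by
  rw [simCore_moveSum, simLaw, map_sum]
  refine Finset.sum_congr rfl fun b _ => ?_
  rw [Finsupp.linearCombination_single, ENNReal.smul_def, smul_eq_mul,
    ENNReal.coe_toNNReal ((M.decideWeight_le_one q a b).trans_lt ENNReal.one_lt_top).ne]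

open Classical in
theorem moveSum_push_cons (q : Q) {c : Γ} (hc : c ≠ M.Z₀) {r : List Γ}
    (hr : (c :: r).length ≤ M.simBound) (a : Γ × (Q → Bool)) :
    M.simCore.moveSum (.push q ⟨c :: r, hr⟩) none a H =
      ∑ g : Q → Bool, productWeight (M.annotatedValue a) g *
        H (.push q ⟨r, (Nat.le_succ _).trans hr⟩) [(c, g), a] := by
  rw [simCore_moveSum, simLaw, if_neg hc, map_sum]
  refine Finset.sum_congr rfl fun g _ => ?_
  rw [Finsupp.linearCombination_single, ENNReal.smul_def, smul_eq_mul,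
    ENNReal.coe_toNNReal ((productWeight_le_one (M.annotatedValue_le_one a) g).trans_lt
      ENNReal.one_lt_top).ne]

theorem moveSum_push_bottom (q : Q) {r : List Γ} (hr : (M.Z₀ :: r).length ≤ M.simBound)
    (a : Γ × (Q → Bool)) :
    M.simCore.moveSum (.push q ⟨M.Z₀ :: r, hr⟩) none a H =
      H (.push q ⟨r, (Nat.le_succ _).trans hr⟩) [a] := by
  rw [simCore_moveSum, simLaw, if_pos rfl]
  simp

theorem moveSum_push_none_one (q : Q) (r : {l : List Γ // l.length ≤ M.simBound})
    (a : Γ × (Q → Bool)) : (M.simCore.moveSum (.push q r) none a fun _ _ => 1) = 1 := by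
  obtain ⟨_ | ⟨c, r⟩, hr⟩ := r
  · simpa only [moveSum_push_nil, mul_one] using M.sum_decideWeight q a
  · by_cases hc : c = M.Z₀
    · subst hc
      rw [moveSum_push_bottom]
    · simpa only [moveSum_push_cons _ _ _ hc, mul_one] using
        sum_productWeight (M.annotatedValue_le_one a)

theorem moveSum_init_none :
    M.simCore.moveSum .init none M.simBottom H =
      ∑ b, M.value b ⟨M.q₀, Tape.region [], [M.Z₀]⟩ * H (.done b) [M.simBottom] := by
  rw [simCore_moveSum, simLaw, if_pos rfl, map_sum]
  refine Finset.sum_congr rfl fun b _ => ?_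
  rw [Finsupp.linearCombination_single, ENNReal.smul_def, smul_eq_mul,
    ENNReal.coe_toNNReal ((M.value_le_one (reachable_init []) b).trans_lt ENNReal.one_lt_top).ne]

theorem moveSum_init_none_of_ne {a : Γ × (Q → Bool)} (ha : a ≠ M.simBottom) :
    M.simCore.moveSum .init none a H = 0 := by
  rw [simCore_moveSum, simLaw, if_neg ha, map_zero]

theorem moveSum_init_some_of_ne {a : Γ × (Q → Bool)} (ha : a ≠ M.simBottom) (σ : A) :
    M.simCore.moveSum .init (some σ) a H = H (.done false) [a] := by
  rw [simCore_moveSum, simLaw, if_neg ha]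
  simp

/-- Truncation in `Sim.pushList` assigns every outcome to exactly one state, so no mass is lost and
no height bound is needed here. The bound enters only in termination and correctness. -/
theorem sum_firstWeight_mul (σ : A) (k : M.Sim → ℝ≥0∞) :
    ∑ x, k (.push x.1 x.2) * M.firstWeight σ x =
      M.firstSum σ (fun p w => k (Sim.pushList M p w.dropLast.reverse)) M.start := by
  classical
  simp only [firstWeight]
  rw [← firstSum_sum_mul]
  congr 1
  ext p w
  rw [Finset.sum_eq_single
    (p, ⟨w.dropLast.reverse.take M.simBound, List.length_take_le _ _⟩)]
  · simp [Sim.pushList]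
  · intro x _ hx
    rw [if_neg, mul_zero]
    intro h
    simp only [Sim.pushList, SimState.push.injEq] at h
    exact hx (Prod.ext h.1.symm h.2.symm)
  · simp

theorem firstWeight_le_one (σ : A) (x : Q × {l : List Γ // l.length ≤ M.simBound}) :
    M.firstWeight σ x ≤ 1 := by
  have h := M.sum_firstWeight_mul σ fun _ => 1
  rw [firstSum_one] at h
  simp only [one_mul] at h
  rw [← h]
  exact Finset.single_le_sum (f := fun x => M.firstWeight σ x) (fun _ _ => zero_le)
    (Finset.mem_univ x)

theorem moveSum_init_some (σ : A) :
    M.simCore.moveSum .init (some σ) M.simBottom H =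
      M.firstSum σ (fun p w => H (Sim.pushList M p w.dropLast.reverse) [M.simBottom])
        M.start := by
  rw [simCore_moveSum, simLaw, if_pos rfl, map_sum,
    ← M.sum_firstWeight_mul σ fun q => H q [M.simBottom]]
  refine Finset.sum_congr rfl fun x _ => ?_
  rw [Finsupp.linearCombination_single, ENNReal.smul_def, smul_eq_mul, mul_comm,
    ENNReal.coe_toNNReal ((M.firstWeight_le_one σ x).trans_lt ENNReal.one_lt_top).ne]

end Moves

/-! ### Termination of the simulator -/

section Termination

theorem done_terminates (b : Bool) (x : List A) (s : List (Γ × (Q → Bool))) :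
    M.simCore.Terminates ⟨.done b, x, s⟩ := by
  induction x generalizing s with
  | nil =>
    refine Acc.intro _ fun d hd => ?_
    cases hd with
    | lam _ _ a w p u h => exact absurd rfl (simLaw_done_pos h).1
  | cons σ x ih =>
    refine Acc.intro _ fun d hd => ?_
    cases hd with
    | lam _ _ a w p u h => exact absurd rfl (simLaw_done_pos h).1
    | read _ _ _ a w p u h =>
      obtain ⟨-, rfl, rfl⟩ := simLaw_done_pos h
      exact ih _

theorem decided_halt_terminates {q : Q} (hq : q ∈ M.halt) (b : Bool) (x : List A)
    (s : List (Γ × (Q → Bool))) : M.simCore.Terminates ⟨.decided q b, x, s⟩ := by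
  induction x generalizing s with
  | nil =>
    refine Acc.intro _ fun d hd => ?_
    cases hd with
    | lam _ _ a w p u h => exact absurd rfl (simLaw_decided_halt_pos hq h).1
  | cons σ x ih =>
    refine Acc.intro _ fun d hd => ?_
    cases hd with
    | lam _ _ a w p u h => exact absurd rfl (simLaw_decided_halt_pos hq h).1
    | read _ _ _ a w p u h =>
      obtain ⟨-, rfl, rfl⟩ := simLaw_decided_halt_pos hq h
      exact ih _

theorem card_pos : 0 < Fintype.card Q ∧ 0 < Fintype.card Γ ∧ 0 < M.pushSize :=
  ⟨Fintype.card_pos_iff.2 ⟨M.q₀⟩, Fintype.card_pos_iff.2 ⟨M.Z₀⟩, M.pushSize_spec.1⟩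

/-- The summands account for the move on the left endmarker, the λ-moves after it, and the move
reading the first symbol. -/
theorem three_mul_pushSize_le : M.pushSize + M.pushSize * (Fintype.card Q * Fintype.card Γ) +
    M.pushSize ≤ M.simBound := by
  obtain ⟨h1, h2, h3⟩ := card_pos (M := M)
  have : 1 ≤ Fintype.card Q * Fintype.card Γ := Nat.mul_pos h1 h2
  have := Nat.mul_le_mul_left M.pushSize this
  unfold simBound
  rw [mul_assoc, mul_assoc]
  omega

theorem pushList_eq {q : Q} {r : List Γ} (hr : r.length ≤ M.simBound) :
    Sim.pushList M q r = .push q ⟨r, hr⟩ := by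
  simp only [Sim.pushList, SimState.push.injEq, true_and]
  exact Subtype.ext (List.take_of_length_le hr)

theorem length_dropLast_reverse_le {q : Q} {s : Option (Tape A)} {a : Γ} {p : Q} {u : List Γ}
    (h : 0 < M.δ q s a p u) : u.dropLast.reverse.length ≤ M.simBound := by
  have h1 := M.length_le_pushSize h
  have h2 := three_mul_pushSize_le (M := M)
  simp only [List.length_reverse, List.length_dropLast]
  omega

/-- The simulating machine inherits termination. -/
theorem push_terminates {q : Q} {x : List A} {r w : List Γ} {s : List (Γ × (Q → Bool))}
    (h : M.Terminates ⟨q, x.map Tape.sym ++ [Tape.right], r.reverse ++ w⟩)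
    (hok : M.StackOK (r.reverse ++ w)) (hw : w ≠ []) (hs : s.map Prod.fst = w)
    (hr : r.length ≤ M.simBound) :
    M.simCore.Terminates ⟨.push q ⟨r, hr⟩, x, s⟩ := by
  generalize hc : (⟨q, x.map Tape.sym ++ [Tape.right], r.reverse ++ w⟩ :
    Config (Tape A) Q Γ) = c at h
  induction h generalizing q x r w s with
  | intro c hacc ih =>
    subst hc
    -- When everything has been pushed and a verdict drawn, the next move is one of `M`; this uses
    -- up the accessibility hypothesis.
    have hnext : ∀ (b : Bool) (s : List (Γ × (Q → Bool))), s.map Prod.fst = r.reverse ++ w →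
        M.simCore.Terminates ⟨.decided q b, x, s⟩ := by
      intro b s hs
      by_cases hq : q ∈ M.halt
      · exact decided_halt_terminates hq b x s
      refine Acc.intro _ fun d hd => ?_
      rw [← hs] at ih hok
      cases hd with
      | lam _ _ a t p u h =>
        obtain ⟨p', u', hpos, rfl, rfl⟩ := simLaw_decided_pos hq h
        rw [pushList_eq (length_dropLast_reverse_le hpos)]
        have heq : u'.dropLast.reverse.reverse ++
            (List.map Prod.fst (replaceTop a u') ++ List.map Prod.fst t) =
              u' ++ t.map Prod.fst := by
          rw [List.reverse_reverse, ← List.append_assoc, dropLast_append_replaceTop]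
        refine ih ⟨p', x.map Tape.sym ++ [Tape.right], u' ++ t.map Prod.fst⟩
          (PPDACore.Step.lam _ _ _ _ _ _ hpos) (w := (replaceTop a u' ++ t).map Prod.fst)
          ?_ ?_ rfl _ ?_
        · rw [List.map_append, heq]
          exact hok.replace hpos
        · rw [List.map_append]
          exact replaceTop_append_ne_nil hok hpos
        · rw [List.map_append, heq]
      | read _ σ x a t p u h =>
        obtain ⟨p', u', hpos, rfl, rfl⟩ := simLaw_decided_pos hq h
        have hstep := PPDACore.Step.read (M := M.toPPDACore) q (Tape.sym σ)
          (x.map Tape.sym ++ [Tape.right]) a.1 (t.map Prod.fst) p' u' hpos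
        rw [pushList_eq (length_dropLast_reverse_le hpos)]
        have heq : u'.dropLast.reverse.reverse ++
            (List.map Prod.fst (replaceTop a u') ++ List.map Prod.fst t) =
              u' ++ t.map Prod.fst := by
          rw [List.reverse_reverse, ← List.append_assoc, dropLast_append_replaceTop]
        refine ih ⟨p', x.map Tape.sym ++ [Tape.right], u' ++ t.map Prod.fst⟩
          (by simpa using hstep) (w := (replaceTop a u' ++ t).map Prod.fst)
          ?_ ?_ rfl _ ?_
        · rw [List.map_append, heq]
          exact hok.replace hpos
        · rw [List.map_append]
          exact replaceTop_append_ne_nil hok hpos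
        · rw [List.map_append, heq]
    -- Pushing a symbol corresponds to no move of `M`, hence an inner induction on the list.
    clear ih hacc
    induction r generalizing w s with
    | nil =>
      refine Acc.intro _ fun d hd => ?_
      cases hd with
      | lam _ _ a t p u h =>
        obtain ⟨-, ⟨b, rfl⟩, rfl⟩ := simLaw_push_nil_pos h
        exact hnext b _ (by simpa using hs)
      | read _ σ x a t p u h => exact absurd (simLaw_push_nil_pos h).1 (by simp)
    | cons c r ihr =>
      have hc : c ≠ M.Z₀ := by
        have := hok.notMem_of_append hw
        simp at this
        tauto
      refine Acc.intro _ fun d hd => ?_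
      cases hd with
      | lam _ _ a t p u h =>
        obtain ⟨-, rfl, ⟨hc', -⟩ | ⟨-, g, rfl⟩⟩ := simLaw_push_cons_pos h
        · exact absurd hc' hc
        · refine ihr (w := c :: w) (by simpa using hok) (by simp) (by simpa using hs) _ ?_
          simpa using hnext
      | read _ σ x a t p u h => exact absurd (simLaw_push_cons_pos h).1 (by simp)

/-- Positive weight means that the state stands for a halted machine or a configuration that `M`
reaches on `σ :: y`; by the height bound nothing has been cut off. -/
theorem first_terminates {σ : A} {x : Q × {l : List Γ // l.length ≤ M.simBound}}
    (h : M.firstWeight σ x ≠ 0) (y : List A) :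
    M.simCore.Terminates ⟨.push x.1 x.2, y, [M.simBottom]⟩ := by
  classical
  obtain ⟨p, w, hK, hok, hcase⟩ := exists_of_firstSum_ne_zero h
  rw [ne_eq, ite_eq_right_iff, not_forall] at hK
  obtain ⟨hpx, -⟩ := hK
  rw [← hpx]
  have hlen : w.dropLast.reverse.length ≤ M.simBound := by
    have h2 := three_mul_pushSize_le (M := M)
    simp only [List.length_reverse, List.length_dropLast]
    rcases hcase with ⟨-, c, hc, rfl⟩ | ⟨q, a, t, u, hc, hpos, rfl⟩
    · have := length_le_of_start hc
      omega
    · have := length_le_of_start hc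
      have := M.length_le_pushSize hpos
      simp at *
      omega
  rw [pushList_eq hlen]
  obtain ⟨z, hz, rfl⟩ := hok
  refine push_terminates (w := [M.Z₀]) ?_ ?_ (by simp) rfl _
  · simp only [List.dropLast_concat, List.reverse_reverse]
    rcases hcase with ⟨hp, -⟩ | ⟨q, a, t, u, hc, hpos, heq⟩
    · exact terminates_of_halt hp
    · have h1 := reachable_extend_start hc (σ :: y)
      rw [heq]
      refine (h1.step ?_).terminates
      simp only [Config.extend, List.map_cons, List.cons_append, List.nil_append, List.append_nil]
      exact PPDACore.Step.read _ _ _ _ _ _ _ hpos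
  · exact ⟨z, hz, by simp⟩

end Termination

variable (M)

theorem coe_simCore_total (q : M.Sim) (s : Option A) (a : Γ × (Q → Bool)) :
    (M.simCore.total q s a : ℝ≥0∞) = M.simCore.moveSum q s a fun _ _ => 1 :=
  (M.simCore.moveSum_one q s a).symm

/-- The simulating machine. -/
noncomputable def simMachine : NoEndmarkerPPDA A M.Sim (Γ × (Q → Bool)) where
  toPPDACore := M.simCore
  acc_union_rej := Set.union_compl_self _
  total_add_total q σ a hqa := by
    rw [← ENNReal.coe_inj]
    push_cast
    simp only [coe_simCore_total]
    rcases q with _ | b | ⟨q, b⟩ | ⟨q, r, hr⟩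
    · have ha : a ≠ M.simBottom := fun h => hqa (by rw [h]; rfl)
      rw [moveSum_init_some_of_ne _ _ ha, moveSum_init_none_of_ne _ _ ha, add_zero]
    · rw [moveSum_done_none, moveSum_done_some, add_zero]
    · by_cases hq : q ∈ M.halt
      · rw [moveSum_decided_halt_none _ _ hq, moveSum_decided_halt_some _ _ hq, add_zero]
      · rw [moveSum_decided _ _ hq, moveSum_decided _ _ hq, M.moveSum_one, M.moveSum_one]
        exact_mod_cast M.total_add_total q hq (Tape.sym σ) a.1
    · rw [moveSum_push_some, zero_add, moveSum_push_none_one]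
  total_init_read σ := by
    rw [← ENNReal.coe_inj, coe_simCore_total]
    exact (M.moveSum_init_some _ σ).trans (firstSum_one σ)
  total_init_lam := by
    rw [← ENNReal.coe_le_coe, coe_simCore_total]
    refine ((M.moveSum_init_none _).trans ?_).le
    simpa using M.value_add_value (reachable_init [])
  δ_init q s a u := by
    by_contra h
    exact (simLaw_shape (pos_iff_ne_zero.2 h)).1 rfl
  noInfinitePath_nil := by
    rw [← PPDACore.terminates_iff]
    refine Acc.intro _ fun d hd => ?_
    generalize hc : (⟨M.simCore.q₀, [], [M.simCore.Z₀]⟩ :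
      Config A M.Sim (Γ × (Q → Bool))) = c at hd
    cases hd with
    | lam q x a w p u h =>
      injection hc with h1 h2 h3
      injection h3 with h3 h4
      subst h1 h2 h3 h4
      obtain ⟨rfl, ⟨-, b, rfl⟩ | ⟨σ, x, hσ, -⟩⟩ := simLaw_init_bottom_pos h
      · exact done_terminates _ _ _
      · simp at hσ
    | read => simp at hc
  noInfinitePath_cons σ x p u h := by
    rw [← PPDACore.terminates_iff]
    obtain ⟨rfl, ⟨hσ, -⟩ | ⟨τ, y, -, rfl, hy⟩⟩ := simLaw_init_bottom_pos h
    · simp at hσ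
    · exact first_terminates hy x

end EndmarkerPPDA

namespace EndmarkerPPDA

variable {A Q Γ : Type*} [Fintype Q] (M : EndmarkerPPDA A Q Γ)

/-! ### Averaging over the annotations of a stack -/

section Expect

/-- The acceptance probabilities that the topmost annotated symbol determines. -/
noncomputable def topValue : List (Γ × (Q → Bool)) → Q → ℝ≥0∞
  | [], _ => 0
  | a :: _, q => M.annotatedValue a q

theorem topValue_le_one (s : List (Γ × (Q → Bool))) (q : Q) : M.topValue s q ≤ 1 := by
  rcases s with _ | ⟨a, s⟩
  · exact zero_le_one
  · exact M.annotatedValue_le_one a q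

open Classical in
/-- The expectation over all annotations of the stack `w`, where the annotations are chosen
from the bottom to the top. -/
noncomputable def expect : List Γ → (List (Γ × (Q → Bool)) → ℝ≥0∞) →ₗ[ℝ≥0∞] ℝ≥0∞
  | [] => LinearMap.proj []
  | b :: w => (expect w).comp (LinearMap.pi fun s =>
      ∑ g : Q → Bool, productWeight (M.topValue s) g • LinearMap.proj ((b, g) :: s))

theorem expect_nil (F : List (Γ × (Q → Bool)) → ℝ≥0∞) : M.expect [] F = F [] := rfl

open Classical in
theorem expect_cons (b : Γ) (w : List Γ) (F : List (Γ × (Q → Bool)) → ℝ≥0∞) :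
    M.expect (b :: w) F = M.expect w fun s =>
      ∑ g : Q → Bool, productWeight (M.topValue s) g * F ((b, g) :: s) := by
  rw [expect, LinearMap.comp_apply]
  congr 1
  ext s
  simp

theorem expect_congr {w : List Γ} {F F' : List (Γ × (Q → Bool)) → ℝ≥0∞}
    (h : ∀ s, s.map Prod.fst = w → F s = F' s) : M.expect w F = M.expect w F' := by
  induction w generalizing F F' with
  | nil => exact h [] rfl
  | cons b w ih =>
    rw [expect_cons, expect_cons]
    exact ih fun s hs => Finset.sum_congr rfl fun g _ => by rw [h ((b, g) :: s) (by simp [hs])]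

/-- The weights of the top annotation sum to one, so a popped annotation is integrated out. -/
theorem expect_tail (b : Γ) (w : List Γ) (F : List (Γ × (Q → Bool)) → ℝ≥0∞) :
    M.expect (b :: w) (fun s => F s.tail) = M.expect w F := by
  rw [expect_cons]
  congr 1
  ext s
  simp only [List.tail_cons]
  rw [← Finset.sum_mul, sum_productWeight (M.topValue_le_one s), one_mul]

theorem expect_const (w : List Γ) (k : ℝ≥0∞) : M.expect w (fun _ => k) = k := by
  induction w with
  | nil => rfl
  | cons b w ih => exact (M.expect_tail b w fun _ => k).trans ih

/-- The default `0` of `topValue` on the empty stack forces the all-false vector, which is the one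
in `simBottom`. Its choice is harmless, as the bottom marker is never removed. -/
theorem expect_singleton (F : List (Γ × (Q → Bool)) → ℝ≥0∞) :
    M.expect [M.Z₀] F = F [M.simBottom] := by
  classical
  rw [expect_cons, expect_nil, Finset.sum_eq_single fun _ => false]
  · simp [productWeight, bernoulliWeight, topValue, simBottom]
  · intro g _ hg
    obtain ⟨q, hq⟩ := Function.ne_iff.1 hg
    rw [productWeight, Finset.prod_eq_zero (Finset.mem_univ q), zero_mul]
    have hq' : g q = true := by simpa using hq
    simp [bernoulliWeight, topValue, hq']
  · simp

/-- The verdicts for the stack below the topmost symbol. -/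
noncomputable def headVerdict : List (Γ × (Q → Bool)) → Q → ℝ≥0∞
  | [], _ => 0
  | a :: _, p => if a.2 p then 1 else 0

theorem expect_headVerdict (a : Γ) (w : List Γ) (p : Q) :
    M.expect (a :: w) (fun s => headVerdict s p) = M.expect w fun s => M.topValue s p := by
  rw [expect_cons]
  congr 1
  ext s
  exact sum_productWeight_mul (M.topValue_le_one s) p

/-- Induction up the stack: the bits in the top symbol have the right means for the stack below, and
the value at the top is affine in them. -/
theorem expect_topValue {w : List Γ} {q : Q} (h : M.Reachable ⟨q, [], w⟩) :
    M.expect w (fun s => M.topValue s q) = M.value true ⟨q, [], w⟩ := by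
  induction w generalizing q with
  | nil => exact absurd rfl h.stackOK.ne_nil
  | cons b w ih =>
    refine Eq.trans ?_ (M.map_popValue (M.expect (b :: w)) (M.expect_const _ 1) headVerdict
      (w := w) (t := [b]) (fun q _ hq => by rw [expect_headVerdict, ih hq]) h)
    refine M.expect_congr fun s hs => ?_
    rcases s with _ | ⟨a, s⟩
    · simp at hs
    · simp only [List.map_cons, List.cons.injEq] at hs
      rw [← hs.1]
      rfl

/-- The mean of the sampled acceptance probabilities is the acceptance probability of `M`. -/
theorem expect_popValue {w t : List Γ} {q : Q} (a : Γ) (h : M.Reachable ⟨q, [], t ++ w⟩) :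
    M.expect (a :: w) (fun s => M.popValue (headVerdict s) ⟨q, [], t⟩) =
      M.value true ⟨q, [], t ++ w⟩ :=
  M.map_popValue (M.expect (a :: w)) (M.expect_const _ 1) headVerdict
    (fun q _ hq => by rw [expect_headVerdict, M.expect_topValue hq]) h

/-- The effect of replacing the topmost symbol by the last symbol of `u`. -/
def replaceStack : List (Γ × (Q → Bool)) → List Γ → List (Γ × (Q → Bool))
  | [], _ => []
  | a :: s, u => replaceTop a u ++ s

/-- The law of an annotation depends on the stack below and not on the symbol carrying it. So a
replacement preserves the law. -/
theorem expect_replaceStack (a : Γ) (w u : List Γ) (F : List (Γ × (Q → Bool)) → ℝ≥0∞) :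
    M.expect (a :: w) (fun s => F (replaceStack s u)) =
      M.expect (u.getLast?.toList ++ w) F := by
  rcases List.eq_nil_or_concat u with rfl | ⟨v, b, rfl⟩
  · refine Eq.trans ?_ (M.expect_tail a w F)
    refine M.expect_congr fun s hs => ?_
    rcases s with _ | ⟨a, s⟩
    · rfl
    · rfl
  · simp only [List.concat_eq_append, List.getLast?_append, List.getLast?_singleton,
      Option.some_or, Option.toList_some, List.cons_append, List.nil_append, expect_cons]
    simp [replaceStack, replaceTop]

/-- The probability of stopping with verdict `β` when the right endmarker is next. -/
noncomputable def endPart (q : Q) (β : Bool) : List (Γ × (Q → Bool)) → ℝ≥0∞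
  | [] => 0
  | a :: _ => M.decideWeight q a β * M.total q (some Tape.right) a.1

/-- The division in the bias of the decision is undone by the probability of halting here; what
remains is affine in the bits of the top symbol. -/
theorem expect_endPart_true {q : Q} (hq : q ∉ M.halt) {a : Γ} {w : List Γ}
    (h : M.Reachable ⟨q, [Tape.right], a :: w⟩) :
    M.expect (a :: w) (M.endPart q true) =
      M.moveSum q (some Tape.right) a fun p u => M.value true ⟨p, [], u ++ w⟩ := by
  have h1 : M.expect (a :: w) (M.endPart q true) = M.expect (a :: w) fun s =>
      M.moveSum q (some Tape.right) a fun p u => M.popValue (headVerdict s) ⟨p, [], u⟩ := by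
    refine M.expect_congr fun s hs => ?_
    rcases s with _ | ⟨b, s⟩
    · simp at hs
    · simp only [List.map_cons, List.cons.injEq] at hs
      rw [← hs.1, endPart, decideWeight, if_neg hq, bernoulliWeight, cond_true, mul_comm,
        total_mul_endValue_div]
      rfl
  rw [h1, PPDACore.map_moveSum]
  refine M.moveSum_congr fun p u hu => M.expect_popValue a ?_
  exact h.step (PPDACore.Step.read _ _ _ _ _ _ _ hu)

/-- On both sides the two verdicts share the mass of the endmarker move, so rejection follows by
subtraction. -/
theorem expect_endPart (β : Bool) {q : Q} (hq : q ∉ M.halt) {a : Γ} {w : List Γ}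
    (h : M.Reachable ⟨q, [Tape.right], a :: w⟩) :
    M.expect (a :: w) (M.endPart q β) =
      M.moveSum q (some Tape.right) a fun p u => M.value β ⟨p, [], u ++ w⟩ := by
  cases β with
  | true => exact M.expect_endPart_true hq h
  | false =>
    have h1 : M.expect (a :: w) (M.endPart q true) + M.expect (a :: w) (M.endPart q false) =
        M.total q (some Tape.right) a := by
      rw [← map_add, ← M.expect_const (a :: w) (M.total q (some Tape.right) a)]
      refine M.expect_congr fun s hs => ?_
      rcases s with _ | ⟨b, s⟩
      · simp at hs
      · simp only [List.map_cons, List.cons.injEq] at hs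
        have := M.sum_decideWeight q b
        rw [Fintype.sum_bool] at this
        rw [Pi.add_apply, endPart, endPart, ← add_mul, this, one_mul, hs.1]
    have h2 : (M.moveSum q (some Tape.right) a fun p u => M.value true ⟨p, [], u ++ w⟩) +
        (M.moveSum q (some Tape.right) a fun p u => M.value false ⟨p, [], u ++ w⟩) =
        M.total q (some Tape.right) a := by
      rw [← PPDACore.moveSum_add, ← PPDACore.moveSum_one]
      exact M.moveSum_congr fun p u hu =>
        M.value_add_value (h.step (PPDACore.Step.read _ _ _ _ _ _ _ hu))
    rw [← M.expect_endPart_true hq h, ← h1] at h2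
    -- Cancellation in `ℝ≥0∞` requires the common summand to be finite.
    refine ((ENNReal.add_right_inj ?_).1 h2).symm
    refine ne_top_of_le_ne_top (ENNReal.coe_ne_top (r := M.total q (some Tape.right) a)) ?_
    rw [← h1]
    exact le_self_add

end Expect

variable [Fintype Γ]

/-! ### First-step equations for the simulator -/

section SimValue

/-- The accepting or the rejecting states of the simulating machine. -/
def simVerdict (β : Bool) : Set M.Sim := cond β M.simMachine.acc M.simMachine.rej

theorem done_mem_simVerdict (b β : Bool) : .done b ∈ M.simVerdict β ↔ b = β := by
  cases β <;> cases b <;> simp [simVerdict, simMachine, simCore]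

theorem decided_mem_simVerdict (q : Q) (b β : Bool) :
    .decided q b ∈ M.simVerdict β ↔ b = β := by
  cases β <;> cases b <;> simp [simVerdict, simMachine, simCore]

/-- The probability that the simulating machine, started in `c`, halts with verdict `β`. -/
noncomputable def simValue (β : Bool) (c : Config A M.Sim (Γ × (Q → Bool))) : ℝ≥0∞ :=
  M.simCore.allPathSum (M.simMachine.haltWeight (M.simVerdict β)) c

theorem simValue_eq (β : Bool) (c : Config A M.Sim (Γ × (Q → Bool))) :
    M.simValue β c = M.simMachine.haltWeight (M.simVerdict β) c +
      M.simCore.next (M.simValue β) c :=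
  M.simCore.allPathSum_eq _ _

open Classical in
theorem haltWeight_nil (F : Set M.Sim) (q : M.Sim) (a : Γ × (Q → Bool))
    (s : List (Γ × (Q → Bool))) : M.simMachine.haltWeight F ⟨q, [], a :: s⟩ =
      if q ∈ F then 1 - M.simCore.moveSum q none a (fun _ _ => 1) else 0 := by
  rw [NoEndmarkerPPDA.haltWeight, ← coe_simCore_total]
  rfl

theorem haltWeight_cons (F : Set M.Sim) (q : M.Sim) (σ : A) (x : List A)
    (s : List (Γ × (Q → Bool))) : M.simMachine.haltWeight F ⟨q, σ :: x, s⟩ = 0 := by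
  simp [NoEndmarkerPPDA.haltWeight]

open Classical in
theorem simValue_done (β b : Bool) (x : List A) (a : Γ × (Q → Bool))
    (s : List (Γ × (Q → Bool))) :
    M.simValue β ⟨.done b, x, a :: s⟩ = if b = β then 1 else 0 := by
  induction x with
  | nil =>
    rw [simValue_eq, haltWeight_nil]
    simp only [PPDACore.next, moveSum_done_none, done_mem_simVerdict, tsub_zero, add_zero]
  | cons σ x ih =>
    rw [simValue_eq, haltWeight_cons]
    simp only [PPDACore.next, moveSum_done_none, moveSum_done_some, zero_add]
    exact ih

open Classical in
theorem simValue_decided_halt (β b : Bool) {q : Q} (hq : q ∈ M.halt) (x : List A)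
    (a : Γ × (Q → Bool)) (s : List (Γ × (Q → Bool))) :
    M.simValue β ⟨.decided q b, x, a :: s⟩ = if b = β then 1 else 0 := by
  induction x with
  | nil =>
    rw [simValue_eq, haltWeight_nil]
    simp only [PPDACore.next, moveSum_decided_halt_none _ _ hq, decided_mem_simVerdict, tsub_zero,
      add_zero]
  | cons σ x ih =>
    rw [simValue_eq, haltWeight_cons]
    simp only [PPDACore.next, moveSum_decided_halt_none _ _ hq, moveSum_decided_halt_some _ _ hq,
      zero_add]
    exact ih

theorem simValue_push (β : Bool) (q : Q) (r : {l : List Γ // l.length ≤ M.simBound})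
    (x : List A) (a : Γ × (Q → Bool)) (s : List (Γ × (Q → Bool))) :
    M.simValue β ⟨.push q r, x, a :: s⟩ =
      M.simCore.moveSum (.push q r) none a fun p u => M.simValue β ⟨p, x, u ++ s⟩ := by
  rw [simValue_eq]
  rcases x with _ | ⟨σ, x⟩
  · rw [haltWeight_nil, moveSum_push_none_one, tsub_self, ite_self, zero_add]
    rfl
  · rw [haltWeight_cons, zero_add]
    simp only [PPDACore.next, moveSum_push_some, add_zero]

open Classical in
theorem simValue_push_cons (β : Bool) (q : Q) {c : Γ} (hc : c ≠ M.Z₀) {r : List Γ}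
    (hr : (c :: r).length ≤ M.simBound) (x : List A) {s : List (Γ × (Q → Bool))}
    (hs : s ≠ []) : M.simValue β ⟨.push q ⟨c :: r, hr⟩, x, s⟩ =
      ∑ g : Q → Bool, productWeight (M.topValue s) g *
        M.simValue β ⟨.push q ⟨r, (Nat.le_succ _).trans hr⟩, x, (c, g) :: s⟩ := by
  rcases s with _ | ⟨a, s⟩
  · exact absurd rfl hs
  rw [simValue_push, moveSum_push_cons _ _ _ hc]
  rfl

theorem simValue_push_nil (β : Bool) (q : Q) (x : List A) (a : Γ × (Q → Bool))
    (s : List (Γ × (Q → Bool))) : M.simValue β ⟨.push q ⟨[], Nat.zero_le _⟩, x, a :: s⟩ =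
      ∑ b, M.decideWeight q a b * M.simValue β ⟨.decided q b, x, a :: s⟩ := by
  rw [simValue_push, moveSum_push_nil]
  rfl

open Classical in
theorem simValue_push_nil_halt (β : Bool) {q : Q} (hq : q ∈ M.halt) (x : List A)
    {s : List (Γ × (Q → Bool))} (hs : s ≠ []) :
    M.simValue β ⟨.push q ⟨[], Nat.zero_le _⟩, x, s⟩ = if q ∈ M.verdict β then 1 else 0 := by
  rcases s with _ | ⟨a, s⟩
  · exact absurd rfl hs
  rw [simValue_push_nil]
  simp only [M.simValue_decided_halt β _ hq, mul_ite, mul_one, mul_zero]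
  rw [Finset.sum_ite_eq' Finset.univ β, if_pos (Finset.mem_univ _), decideWeight, if_pos hq]

/-- Halting happens with probability `1 - δ[q,λ,a]`, and the probability requirement of `M`
identifies this with the chance of reading the right endmarker. -/
theorem simValue_decided_nil (β b : Bool) {q : Q} (hq : q ∉ M.halt) (a : Γ × (Q → Bool))
    (s : List (Γ × (Q → Bool))) : M.simValue β ⟨.decided q b, [], a :: s⟩ =
      (if b = β then (M.total q (some Tape.right) a.1 : ℝ≥0∞) else 0) +
      M.moveSum q none a.1 fun p u =>
        M.simValue β ⟨Sim.pushList M p u.dropLast.reverse, [], replaceStack (a :: s) u⟩ := by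
  classical
  have h : (1 : ℝ≥0∞) - M.total q none a.1 = M.total q (some Tape.right) a.1 := by
    rw [← ENNReal.coe_one, ← M.total_add_total q hq Tape.right a.1, ENNReal.coe_add]
    exact ENNReal.add_sub_cancel_right ENNReal.coe_ne_top
  rw [simValue_eq, haltWeight_nil]
  simp only [PPDACore.next, moveSum_decided _ _ hq, Option.map_none, decided_mem_simVerdict,
    PPDACore.moveSum_one, h]
  rfl

theorem simValue_decided_cons (β b : Bool) {q : Q} (hq : q ∉ M.halt) (σ : A) (x : List A)
    (a : Γ × (Q → Bool)) (s : List (Γ × (Q → Bool))) :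
    M.simValue β ⟨.decided q b, σ :: x, a :: s⟩ =
      (M.moveSum q none a.1 fun p u =>
        M.simValue β ⟨Sim.pushList M p u.dropLast.reverse, σ :: x, replaceStack (a :: s) u⟩) +
      M.moveSum q (some (Tape.sym σ)) a.1 fun p u =>
        M.simValue β ⟨Sim.pushList M p u.dropLast.reverse, x, replaceStack (a :: s) u⟩ := by
  rw [simValue_eq, haltWeight_cons, zero_add]
  simp only [PPDACore.next, moveSum_decided _ _ hq, Option.map_none, Option.map_some]
  rfl

theorem simValue_end (β : Bool) {q : Q} (hq : q ∉ M.halt) (a : Γ × (Q → Bool))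
    (s : List (Γ × (Q → Bool))) :
    M.simValue β ⟨.push q ⟨[], Nat.zero_le _⟩, [], a :: s⟩ =
      M.endPart q β (a :: s) + M.moveSum q none a.1 fun p u =>
        M.simValue β ⟨Sim.pushList M p u.dropLast.reverse, [], replaceStack (a :: s) u⟩ := by
  rw [simValue_push_nil]
  simp only [M.simValue_decided_nil β _ hq, mul_add, Finset.sum_add_distrib]
  rw [← Finset.sum_mul, sum_decideWeight, one_mul]
  simp [endPart, -Fintype.univ_bool]

/-- With input left both decisions continue in the same way, so the decision sums out. -/
theorem simValue_cons (β : Bool) {q : Q} (hq : q ∉ M.halt) (σ : A) (x : List A)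
    (a : Γ × (Q → Bool)) (s : List (Γ × (Q → Bool))) :
    M.simValue β ⟨.push q ⟨[], Nat.zero_le _⟩, σ :: x, a :: s⟩ =
      (M.moveSum q none a.1 fun p u =>
        M.simValue β ⟨Sim.pushList M p u.dropLast.reverse, σ :: x, replaceStack (a :: s) u⟩) +
      M.moveSum q (some (Tape.sym σ)) a.1 fun p u =>
        M.simValue β ⟨Sim.pushList M p u.dropLast.reverse, x, replaceStack (a :: s) u⟩ := by
  rw [simValue_push_nil]
  simp only [M.simValue_decided_cons β _ hq]
  rw [← Finset.sum_mul, sum_decideWeight, one_mul]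

end SimValue

/-! ### Correctness of the simulation -/

section Correctness

/-- Sampling a vector for a pushed symbol is exactly the next layer of `expect`, so the average is
the same before and after the push. -/
theorem expect_push (β : Bool) (q : Q) (x : List A) {r w : List Γ}
    (hok : M.StackOK (r.reverse ++ w)) (hw : w ≠ []) (hr : r.length ≤ M.simBound) :
    M.expect w (fun s => M.simValue β ⟨.push q ⟨r, hr⟩, x, s⟩) =
      M.expect (r.reverse ++ w) fun s => M.simValue β ⟨.push q ⟨[], Nat.zero_le _⟩, x, s⟩ := by
  induction r generalizing w with
  | nil => rfl
  | cons c r ih =>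
    have hc : c ≠ M.Z₀ := by
      have := hok.notMem_of_append hw
      simp at this
      tauto
    rw [List.reverse_cons, List.append_assoc, List.singleton_append] at hok ⊢
    rw [← ih hok (by simp) ((Nat.le_succ _).trans hr), expect_cons]
    refine M.expect_congr fun s hs => ?_
    rw [M.simValue_push_cons β q hc hr x]
    rintro rfl
    exact hw hs.symm

/-- Popping or replacing the top and then pushing the remaining symbols carries the annotation law
of `a :: w` to that of `u ++ w`. -/
theorem expect_move (β : Bool) (x : List A) {q : Q} {s : Option (Tape A)} {a : Γ} {p : Q}
    {u w : List Γ} (hok : M.StackOK (a :: w)) (h : 0 < M.δ q s a p u) :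
    M.expect (a :: w) (fun t =>
      M.simValue β ⟨Sim.pushList M p u.dropLast.reverse, x, replaceStack t u⟩) =
    M.expect (u ++ w) fun s => M.simValue β ⟨.push p ⟨[], Nat.zero_le _⟩, x, s⟩ := by
  have heq : u.dropLast.reverse.reverse ++ (u.getLast?.toList ++ w) = u ++ w := by
    rw [List.reverse_reverse, ← List.append_assoc]
    congr 1
    rcases List.eq_nil_or_concat u with rfl | ⟨v, b, rfl⟩ <;> simp
  have hok' := hok.replace h
  rw [M.expect_replaceStack a w u
      fun t => M.simValue β ⟨Sim.pushList M p u.dropLast.reverse, x, t⟩,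
    pushList_eq (length_dropLast_reverse_le h), expect_push, heq]
  · rwa [heq]
  · rcases List.eq_nil_or_concat u with rfl | ⟨v, b, rfl⟩
    · simpa using hok'.ne_nil
    · simp

/-- On average over the annotations, the simulating machine has the same outcomes as `M`. -/
theorem expect_simValue (β : Bool) {q : Q} {x : List A} {w : List Γ}
    (h : M.Reachable ⟨q, x.map Tape.sym ++ [Tape.right], w⟩) :
    M.expect w (fun s => M.simValue β ⟨.push q ⟨[], Nat.zero_le _⟩, x, s⟩) =
      M.value β ⟨q, x.map Tape.sym ++ [Tape.right], w⟩ := by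
  classical
  generalize hc : (⟨q, x.map Tape.sym ++ [Tape.right], w⟩ : Config (Tape A) Q Γ) = c at h
  have hterm := h.terminates
  induction hterm generalizing q x w with
  | intro c _ ih =>
    subst hc
    have hok := h.stackOK
    simp only at hok
    rcases w with _ | ⟨a, w⟩
    · exact absurd rfl hok.ne_nil
    by_cases hq : q ∈ M.halt
    · rw [M.value_of_halt β hq, ← M.expect_const (a :: w) (if q ∈ M.verdict β then 1 else 0)]
      refine M.expect_congr fun s hs => M.simValue_push_nil_halt β hq x ?_
      rintro rfl
      simp at hs
    rw [M.value_of_not_halt β hq]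
    rcases x with _ | ⟨σ, x⟩
    · have h1 : M.expect (a :: w)
          (fun s => M.simValue β ⟨.push q ⟨[], Nat.zero_le _⟩, [], s⟩) =
          M.expect (a :: w) (M.endPart q β + fun s => M.moveSum q none a fun p u =>
            M.simValue β ⟨Sim.pushList M p u.dropLast.reverse, [], replaceStack s u⟩) := by
        refine M.expect_congr fun s hs => ?_
        rcases s with _ | ⟨b, s⟩
        · simp at hs
        · simp only [List.map_cons, List.cons.injEq] at hs
          rw [M.simValue_end β hq, ← hs.1]
          rfl
      -- Both sides split into the endmarker move and the λ-moves; for the former the simulator uses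
      -- its sampled verdict.
      rw [h1, map_add, M.expect_endPart β hq h, PPDACore.map_moveSum, add_comm]
      simp only [List.map_nil, List.nil_append, PPDACore.next]
      congr 1
      refine M.moveSum_congr fun p u hu => ?_
      rw [M.expect_move β [] hok hu]
      have hs := PPDACore.Step.lam (M := M.toPPDACore) q [Tape.right] a w p u hu
      exact ih _ hs rfl (h.step hs)
    · have h1 : M.expect (a :: w)
          (fun s => M.simValue β ⟨.push q ⟨[], Nat.zero_le _⟩, σ :: x, s⟩) =
          M.expect (a :: w) ((fun s => M.moveSum q none a fun p u => M.simValue β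
              ⟨Sim.pushList M p u.dropLast.reverse, σ :: x, replaceStack s u⟩) +
            fun s => M.moveSum q (some (Tape.sym σ)) a fun p u => M.simValue β
              ⟨Sim.pushList M p u.dropLast.reverse, x, replaceStack s u⟩) := by
        refine M.expect_congr fun s hs => ?_
        rcases s with _ | ⟨b, s⟩
        · simp at hs
        · simp only [List.map_cons, List.cons.injEq] at hs
          rw [M.simValue_cons β hq, ← hs.1]
          rfl
      rw [h1, map_add, PPDACore.map_moveSum, PPDACore.map_moveSum]
      simp only [List.map_cons, List.cons_append, PPDACore.next]
      congr 1
      · refine M.moveSum_congr fun p u hu => ?_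
        rw [M.expect_move β (σ :: x) hok hu]
        have hs := PPDACore.Step.lam (M := M.toPPDACore) q
          (Tape.sym σ :: (x.map Tape.sym ++ [Tape.right])) a w p u hu
        exact ih _ hs rfl (h.step hs)
      · refine M.moveSum_congr fun p u hu => ?_
        rw [M.expect_move β x hok hu]
        have hs := PPDACore.Step.read (M := M.toPPDACore) q
          (Tape.sym σ) (x.map Tape.sym ++ [Tape.right]) a w p u hu
        exact ih _ hs rfl (h.step hs)

/-- Nothing is cut off, and over the bare bottom marker the annotation is deterministic. -/
theorem simValue_pushList (β : Bool) (q : Q) (x : List A) {w : List Γ} (hok : M.StackOK w)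
    (hw : w.length ≤ M.simBound) :
    M.simValue β ⟨Sim.pushList M q w.dropLast.reverse, x, [M.simBottom]⟩ =
      M.expect w fun s => M.simValue β ⟨.push q ⟨[], Nat.zero_le _⟩, x, s⟩ := by
  obtain ⟨z, hz, rfl⟩ := hok
  have hz' : z.reverse.length ≤ M.simBound := by
    simp at hw ⊢
    omega
  rw [List.dropLast_concat, pushList_eq hz', ← M.expect_singleton fun s =>
    M.simValue β ⟨.push q ⟨z.reverse, hz'⟩, x, s⟩, expect_push, List.reverse_reverse]
  · exact ⟨z, hz, by simp⟩
  · simp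

/-- The value of `M` is harmonic during the first phase, so the compressed first move reproduces it.
-/
theorem firstSum_simValue (β : Bool) (σ : A) (x : List A) :
    M.firstSum σ (fun p w =>
      M.simValue β ⟨Sim.pushList M p w.dropLast.reverse, x, [M.simBottom]⟩) M.start =
      M.value β ⟨M.q₀, Tape.region (σ :: x), [M.Z₀]⟩ := by
  classical
  have hb := three_mul_pushSize_le (M := M)
  refine firstSum_eq σ (x.map Tape.sym ++ [Tape.right]) (V := M.value β) ?_ ?_ ?_ .refl
  · intro c hc hhalt
    have hok := stackOK_of_start hc
    have hlen := length_le_of_start hc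
    rw [M.simValue_pushList β _ x hok (by omega), M.value_of_halt β (by exact hhalt)]
    refine Eq.trans ?_ (M.expect_const c.stack _)
    refine M.expect_congr fun s hs => M.simValue_push_nil_halt β hhalt x ?_
    rintro rfl
    exact hok.ne_nil hs.symm
  · intro q a w p u hc hu
    have hok := (stackOK_of_start hc).replace hu
    have hlen := length_le_of_start hc
    have hlen' := M.length_le_pushSize hu
    rw [M.simValue_pushList β _ x hok (by simp at *; omega)]
    refine M.expect_simValue β ?_
    have h1 := reachable_extend_start hc (σ :: x)
    refine h1.step ?_
    simp only [Config.extend, List.map_cons, List.cons_append, List.nil_append, List.append_nil]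
    exact PPDACore.Step.read _ _ _ _ _ _ _ hu
  · intro c _ hc
    exact M.value_of_not_halt β hc

theorem simMachine_outcomeProb (β : Bool) (x : List A) :
    M.simMachine.outcomeProb (M.simVerdict β) x =
      M.value β ⟨M.q₀, Tape.region x, [M.Z₀]⟩ := by
  classical
  rcases x with _ | ⟨σ, x⟩
  · change M.simValue β ⟨.init, [], [M.simBottom]⟩ = _
    rw [simValue_eq, haltWeight_nil]
    simp only [PPDACore.next, moveSum_init_none]
    -- The λ-moves out of `init` have total one, so halting in `init` contributes nothing.
    have h := M.value_add_value (reachable_init [])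
    simp only [Fintype.sum_bool, mul_one, h, tsub_self, ite_self, zero_add, List.append_nil,
      simValue_done]
    cases β <;> simp
  · rw [← firstSum_simValue]
    exact M.moveSum_init_some (fun p u => M.simValue β ⟨p, x, u⟩) σ

theorem errorEquivalent_simMachine : ErrorEquivalent M M.simMachine := by
  have hacc : ∀ x, M.accProb x = M.simMachine.accProb x :=
    fun x => (M.simMachine_outcomeProb true x).symm
  have hrej : ∀ x, M.rejProb x = M.simMachine.rejProb x :=
    fun x => (M.simMachine_outcomeProb false x).symm
  refine ⟨?_, fun x => ⟨hacc x, hrej x⟩⟩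
  ext x
  change 1 / 2 < M.accProb x ↔ 1 / 2 < M.simMachine.accProb x
  rw [hacc]

end Correctness

end EndmarkerPPDA

/-! ### Renaming states and stack symbols -/

section Transport

variable {T Q Γ Q' Γ' : Type*}

/-- Rename the states and the stack symbols of a configuration. -/
def Config.map (f : Q → Q') (g : Γ → Γ') (c : Config T Q Γ) : Config T Q' Γ' :=
  ⟨f c.state, c.input, c.stack.map g⟩

namespace PPDACore

/-- Rename the states and the stack symbols of a machine. -/
def transport (M : PPDACore T Q Γ) (f : Q ≃ Q') (g : Γ ≃ Γ') : PPDACore T Q' Γ' where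
  Θ := M.Θ.map ⟨List.map g, List.map_injective_iff.2 g.injective⟩
  nil_mem := Finset.mem_map.2 ⟨[], M.nil_mem, rfl⟩
  δ q s a p u := M.δ (f.symm q) s (g.symm a) (f.symm p) (u.map g.symm)
  q₀ := f M.q₀
  Z₀ := g M.Z₀
  acc := f.symm ⁻¹' M.acc
  rej := f.symm ⁻¹' M.rej
  disjoint_acc_rej := M.disjoint_acc_rej.preimage _
  δ_eq_zero_of_notMem q s a p u hu := by
    refine M.δ_eq_zero_of_notMem _ _ _ _ _ fun h => hu (Finset.mem_map.2 ⟨_, h, ?_⟩)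
    simp
  δ_of_ne q s a p u h ha hu := by
    refine M.δ_of_ne _ _ _ _ _ h (fun h' => ha ?_) ?_
    · rw [← h', Equiv.apply_symm_apply]
    · exact List.mem_map.2 ⟨_, hu, g.symm_apply_apply _⟩
  δ_of_eq q s p u h := by
    rw [Equiv.symm_apply_apply] at h
    obtain ⟨v, hv, hu⟩ := M.δ_of_eq _ _ _ _ h
    refine ⟨v.map g, ?_, ?_⟩
    · rw [List.mem_map]
      rintro ⟨b, hb, hbZ⟩
      rw [g.injective hbZ] at hb
      exact hv hb
    · have := congrArg (List.map g) hu
      simpa using this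

variable (M : PPDACore T Q Γ) (f : Q ≃ Q') (g : Γ ≃ Γ')

theorem transport_step {c d : Config T Q' Γ'} (h : (M.transport f g).Step c d) :
    M.Step (c.map f.symm g.symm) (d.map f.symm g.symm) := by
  cases h with
  | lam q x a w p u h =>
    simpa [Config.map] using Step.lam (M := M) (f.symm q) x (g.symm a) (w.map g.symm)
      (f.symm p) (u.map g.symm) h
  | read q σ x a w p u h =>
    simpa [Config.map] using Step.read (M := M) (f.symm q) σ x (g.symm a) (w.map g.symm)
      (f.symm p) (u.map g.symm) h

theorem transport_noInfinitePath {c : Config T Q' Γ'}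
    (h : M.NoInfinitePath (c.map f.symm g.symm)) : (M.transport f g).NoInfinitePath c := by
  rintro ⟨F, hF, hstep⟩
  exact h ⟨fun i => (F i).map f.symm g.symm, by simp only [hF], fun i => M.transport_step f g (hstep i)⟩

theorem transport_pushesSingleSymbols (h : M.PushesSingleSymbols) :
    (M.transport f g).PushesSingleSymbols := by
  refine ⟨fun u hu => ?_, fun q s a p u hu => ?_⟩
  · obtain ⟨v, hv, rfl⟩ := Finset.mem_map.1 hu
    simpa using h.1 v hv
  · rcases h.2 _ _ _ _ _ hu with h | ⟨b, h⟩ | ⟨b, h⟩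
    · exact .inl (by simpa using h)
    · exact .inr (.inl ⟨g b, by simpa using congrArg (List.map g) h⟩)
    · exact .inr (.inr ⟨g b, by simpa using congrArg (List.map g) h⟩)

variable [Fintype Q] [Fintype Q']

theorem transport_sum {R : Type*} [AddCommMonoid R] (F : Q → List Γ → R) :
    ∑ p : Q', ∑ u ∈ (M.transport f g).Θ, F (f.symm p) (u.map g.symm) =
      ∑ p : Q, ∑ u ∈ M.Θ, F p u := by
  rw [← Equiv.sum_comp f.symm]
  simp [transport]

theorem transport_total (q : Q') (s : Option T) (a : Γ') :
    (M.transport f g).total q s a = M.total (f.symm q) s (g.symm a) :=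
  M.transport_sum f g fun p u => M.δ (f.symm q) s (g.symm a) p u

theorem transport_moveSum (q : Q') (s : Option T) (a : Γ') (H : Q → List Γ → ℝ≥0∞) :
    ((M.transport f g).moveSum q s a fun p u => H (f.symm p) (u.map g.symm)) =
      M.moveSum (f.symm q) s (g.symm a) H :=
  M.transport_sum f g fun p u => (M.δ (f.symm q) s (g.symm a) p u : ℝ≥0∞) * H p u

theorem transport_next (V : Config T Q Γ → ℝ≥0∞) (c : Config T Q' Γ') :
    (M.transport f g).next (fun d => V (d.map f.symm g.symm)) c =
      M.next V (c.map f.symm g.symm) := by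
  obtain ⟨q, x, w⟩ := c
  rcases w with _ | ⟨a, w⟩
  · simp [next, Config.map]
  rcases x with _ | ⟨σ, x⟩
  · simp only [next, Config.map, List.map_cons, List.map_append]
    exact M.transport_moveSum f g q none a fun p u => V ⟨p, [], u ++ w.map g.symm⟩
  · simp only [next, Config.map, List.map_cons, List.map_append]
    exact congrArg₂ (· + ·)
      (M.transport_moveSum f g q none a fun p u => V ⟨p, σ :: x, u ++ w.map g.symm⟩)
      (M.transport_moveSum f g q (some σ) a fun p u => V ⟨p, x, u ++ w.map g.symm⟩)

theorem transport_pathSum (final : Config T Q Γ → ℝ≥0∞) (k : ℕ) (c : Config T Q' Γ') :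
    (M.transport f g).pathSum (fun d => final (d.map f.symm g.symm)) k c =
      M.pathSum final k (c.map f.symm g.symm) := by
  induction k generalizing c with
  | zero => simp only [pathSum]
  | succ k ih => rw [pathSum_succ, pathSum_succ, ← transport_next, funext ih]

theorem transport_allPathSum (final : Config T Q Γ → ℝ≥0∞) (c : Config T Q' Γ') :
    (M.transport f g).allPathSum (fun d => final (d.map f.symm g.symm)) c =
      M.allPathSum final (c.map f.symm g.symm) := by
  simp only [allPathSum, transport_pathSum]

end PPDACore

namespace NoEndmarkerPPDA

variable {A : Type*} [Fintype Q] [Fintype Q']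

/-- Rename the states and the stack symbols of a machine. -/
def transport (N : NoEndmarkerPPDA A Q Γ) (f : Q ≃ Q') (g : Γ ≃ Γ') : NoEndmarkerPPDA A Q' Γ' where
  toPPDACore := N.toPPDACore.transport f g
  acc_union_rej := by
    change f.symm ⁻¹' N.acc ∪ f.symm ⁻¹' N.rej = _
    rw [← Set.preimage_union, N.acc_union_rej, Set.preimage_univ]
  total_add_total q σ a h := by
    rw [PPDACore.transport_total, PPDACore.transport_total]
    refine N.total_add_total _ _ _ fun h' => h ?_
    rw [Prod.mk.injEq, Equiv.symm_apply_eq, Equiv.symm_apply_eq] at h'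
    rw [h'.1, h'.2]
    rfl
  total_init_read σ := by
    rw [PPDACore.transport_total]
    simpa [PPDACore.transport] using N.total_init_read σ
  total_init_lam := by
    rw [PPDACore.transport_total]
    simpa [PPDACore.transport] using N.total_init_lam
  δ_init q s a u := by
    simpa [PPDACore.transport] using N.δ_init (f.symm q) s (g.symm a) (u.map g.symm)
  noInfinitePath_nil := by
    refine N.transport_noInfinitePath f g ?_
    simpa [PPDACore.transport, Config.map] using N.noInfinitePath_nil
  noInfinitePath_cons σ x p u h := by
    refine N.transport_noInfinitePath f g (N.noInfinitePath_cons σ x (f.symm p) (u.map g.symm) ?_)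
    simpa [PPDACore.transport] using h

variable (N : NoEndmarkerPPDA A Q Γ) (f : Q ≃ Q') (g : Γ ≃ Γ')

theorem transport_haltWeight (F : Set Q) (c : Config A Q' Γ') :
    (N.transport f g).haltWeight (f.symm ⁻¹' F) c = N.haltWeight F (c.map f.symm g.symm) := by
  obtain ⟨q, x, w⟩ := c
  rcases w with _ | ⟨a, w⟩
  · cases x <;> simp [haltWeight, Config.map]
  rcases x with _ | ⟨σ, x⟩
  · simp only [haltWeight, Config.map, List.map_cons, Set.mem_preimage]
    have : (N.transport f g).total q none a = N.total (f.symm q) none (g.symm a) :=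
      N.transport_total f g q none a
    rw [this]
    rfl
  · simp [haltWeight, Config.map]

theorem transport_outcomeProb (F : Set Q) (x : List A) :
    (N.transport f g).outcomeProb (f.symm ⁻¹' F) x = N.outcomeProb F x := by
  have hw := funext (N.transport_haltWeight f g F)
  rcases x with _ | ⟨σ, x⟩
  · simp only [outcomeProb]
    rw [hw]
    refine (N.transport_allPathSum f g _ _).trans ?_
    simp [transport, PPDACore.transport, Config.map]
  · simp only [outcomeProb]
    rw [hw, ← N.transport_sum f g]
    refine Finset.sum_congr rfl fun p _ => Finset.sum_congr rfl fun u _ => ?_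
    refine congrArg₂ (· * ·) ?_ (N.transport_allPathSum f g _ _)
    simp [transport, PPDACore.transport]

theorem _root_.ErrorEquivalent.transport {Q₀ Γ₀ : Type*} [Fintype Q₀] {M : EndmarkerPPDA A Q₀ Γ₀}
    {N : NoEndmarkerPPDA A Q Γ} (h : ErrorEquivalent M N) (f : Q ≃ Q') (g : Γ ≃ Γ') :
    ErrorEquivalent M (N.transport f g) := by
  have hacc : ∀ x, (N.transport f g).accProb x = N.accProb x := N.transport_outcomeProb f g N.acc
  have hrej : ∀ x, (N.transport f g).rejProb x = N.rejProb x := N.transport_outcomeProb f g N.rej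
  refine ⟨h.1.trans ?_, fun x => ⟨(h.2 x).1.trans (hacc x).symm, (h.2 x).2.trans (hrej x).symm⟩⟩
  ext x
  change 1 / 2 < N.accProb x ↔ 1 / 2 < (N.transport f g).accProb x
  rw [hacc]

end NoEndmarkerPPDA

end Transport

/-! ### Counting states and stack symbols -/

namespace EndmarkerPPDA

variable {A Q Γ : Type*} [Fintype Q] [Fintype Γ] (M : EndmarkerPPDA A Q Γ)

/-- By `m + 1 ≤ 2m` the count is at most `3 + 2n + n(2m)^L`, where `L = 3enm` is the exponent in
`stateBound`. The constant is `6 = 3 + 2 + 1`. -/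
theorem card_sim_le : Fintype.card M.Sim ≤
    6 * stateBound (Fintype.card Q) (Fintype.card Γ) M.pushSize := by
  obtain ⟨hn, hm, he⟩ := card_pos (M := M)
  refine SimState.card_le.trans ?_
  rw [stateBound, ← simBound]
  have h1 : (Fintype.card Γ + 1) ^ M.simBound ≤ (2 * Fintype.card Γ) ^ M.simBound :=
    Nat.pow_le_pow_left (by omega) _
  generalize Fintype.card Q = n at *
  generalize Fintype.card Γ = m at *
  generalize M.pushSize = e at *
  generalize M.simBound = L at *
  have h2 : 1 ≤ (2 * m) ^ L := Nat.one_le_pow _ _ (by omega)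
  have h3 : n * (m + 1) ^ L ≤ n * (2 * m) ^ L := Nat.mul_le_mul_left _ h1
  have h4 : n * 1 ≤ n * (2 * m) ^ L := Nat.mul_le_mul_left _ h2
  have h5 : n ≤ e ^ 2 * n ^ 4 * m ^ 4 := by
    calc n = 1 * n ^ 1 * 1 := by ring
      _ ≤ e ^ 2 * n ^ 4 * m ^ 4 := Nat.mul_le_mul (Nat.mul_le_mul (Nat.one_le_pow _ _ he)
        (Nat.pow_le_pow_right hn (by norm_num))) (Nat.one_le_pow _ _ hm)
  have h6 : n * (2 * m) ^ L ≤ e ^ 2 * n ^ 4 * m ^ 4 * (2 * m) ^ L := Nat.mul_le_mul_right _ h5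
  omega

/-- The `m * 2 ^ n` annotated symbols are far below the bound; all remaining factors are at least
one. -/
theorem card_symbols_le : Nat.card (Γ × (Q → Bool)) ≤
    stackBound (Fintype.card Q) (Fintype.card Γ) M.pushSize := by
  obtain ⟨hn, hm, he⟩ := card_pos (M := M)
  rw [Nat.card_prod, Nat.card_fun, Nat.card_eq_fintype_card, Nat.card_eq_fintype_card,
    Nat.card_eq_fintype_card, Fintype.card_bool, stackBound]
  generalize Fintype.card Q = n at *
  generalize Fintype.card Γ = m at *
  generalize M.pushSize = e at *
  refine Nat.mul_le_mul ?_ (Nat.pow_le_pow_right (by norm_num) ?_)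
  · calc m = 1 * 1 * m ^ 1 * 1 := by ring
      _ ≤ _ := Nat.mul_le_mul (Nat.mul_le_mul (Nat.mul_le_mul (Nat.one_le_pow _ _ he)
        (Nat.one_le_pow _ _ hn)) (Nat.pow_le_pow_right hm (by norm_num)))
        (Nat.one_le_pow _ _ (by omega))
  · calc n = 1 * n ^ 1 * 1 * 1 := by ring
      _ ≤ _ := Nat.mul_le_mul (Nat.mul_le_mul (Nat.mul_le_mul (by omega)
        (Nat.pow_le_pow_right hn (by norm_num))) (Nat.one_le_pow _ _ hm))
        (Nat.one_le_pow _ _ (by omega))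

end EndmarkerPPDA

theorem mainTheorem2 :
    ∃ C : ℕ, ∀ (A Q Γ : Type*) [Finite A] [Nonempty A] [Fintype Q] [Fintype Γ]
      (M : EndmarkerPPDA A Q Γ),
      ∃ (Q' Γ' : Type) (_ : Fintype Q') (_ : Fintype Γ') (N : NoEndmarkerPPDA A Q' Γ'),
        ErrorEquivalent M N ∧
        N.PushesSingleSymbols ∧
        Fintype.card Q' ≤ C * stateBound (Fintype.card Q) (Fintype.card Γ) M.pushSize ∧
        Fintype.card Γ' ≤ C * stackBound (Fintype.card Q) (Fintype.card Γ) M.pushSize := by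
  refine ⟨6, fun A Q Γ _ _ _ _ M => ?_⟩
  -- The simulator lives in the universes of `Q` and `Γ`, whereas the types asked for lie in `Type`.
  let f : M.Sim ≃ Fin (Fintype.card M.Sim) := Fintype.equivFin _
  let g : Γ × (Q → Bool) ≃ Fin (Nat.card (Γ × (Q → Bool))) := Finite.equivFin _
  refine ⟨_, _, inferInstance, inferInstance, M.simMachine.transport f g,
    M.errorEquivalent_simMachine.transport f g,
    M.simCore.transport_pushesSingleSymbols f g M.simCore_pushesSingleSymbols, ?_, ?_⟩
  · rw [Fintype.card_fin]
    exact M.card_sim_le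
  · rw [Fintype.card_fin]
    exact M.card_symbols_le.trans (Nat.le_mul_of_pos_left _ (by norm_num))
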